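/- **Theorem.** Let $R$ be a Dedekind domain with fraction field $K$ and ideal class group $\operatorname{cl}(R)$, and suppose that $2 \le |\operatorname{cl}(R)| < \infty$. Let $n \ge 1$ and let $\omega$ be a symplectic form on $R^{2n}$, i.e. a bilinear form with $\omega(x,x)=0$ for all $x$ such that $x \mapsto \omega(x,-)$ and $y \mapsto \omega(-,y)$ are bijections $R^{2n} \to \operatorname{Hom}_R(R^{2n},R)$. Denote the induced form on $K^{2n}$ by $\omega$ as well. Let $T^\omega(K^{2n})$ be the order complex of the poset of non-zero isotropic subspaces of $K^{2n}$, and let $$\operatorname{St}^\omega_n(K) = \tilde H_{n-1}(T^\omega(K^{2n});\mathbb{Z})$$ be the symplectic Steinberg module. A symplectic frame of $K^{2n}$ is a family $\mathbf L = (L_1,\dots,L_n,L_{-n},\dots,L_{-1})$ of one-dimensional subspaces such that $L_i+L_j$ is isotropic if and only if $j \neq -i$. Its apartment class is $$[\Sigma_{\mathbf L}] = \sum_{\sigma} (-1)^{\operatorname{len}(\sigma)}\,\bigl(L_{\sigma([1])} \subset L_{\sigma([2])} \subset \dots \subset L_{\sigma([n])}\bigr) \in \operatorname{St}^\omega_n(K),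 \qquad L_{\sigma([m])} = \bigoplus_{i=1}^m L_{\sigma(i)},$$ where $\sigma$ runs through the signed permutations, i.e. the permutations of $\{\pm1,\dots,\pm n\}$ with $\sigma(-i)=-\sigma(i)$, and $\operatorname{len}$ is the word length with respect to the simple reflections $s_1, \dots, s_n$: for $i<n$, $s_i$ exchanges $i$ and $i+1$ (and $-i$ and $-(i+1)$), and $s_n$ exchanges $n$ and $-n$. The frame $\mathbf L$ and its apartment class are called integral if $R^{2n}$ is the direct sum of its submodules $L_i \cap R^{2n}$, $i \in \{\pm 1,\dots,\pm n\}$. Then $\operatorname{St}^\omega_n(K)$ is not generated, as an abelian group, by the integral apartment classes. -/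

import Mathlib

noncomputable section

namespace SymplecticSteinberg

/-! ### Reduced simplicial homology of the order complex of a poset -/

section OrderComplex

variable (P : Type*) [PartialOrder P]

/-- The simplices with `m` vertices (of dimension `m - 1`) of the order complex of `P`:
strictly increasing chains `p 0 < ⋯ < p (m - 1)`. For `m = 0` this is the empty simplex. -/
def Flag (m : ℕ) : Type _ := {p : Fin m → P // StrictMono p}

variable {P}

/-- The `i`-th face of a simplex: the vertex with index `i` is removed. -/
def Flag.face {m : ℕ} (p : Flag P (m + 1)) (i : Fin (m + 1)) : Flag P m :=
  ⟨p.1 ∘ i.succAbove, p.2.comp (Fin.strictMono_succAbove i)⟩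

variable (P)

/-- Simplicial chains with integer coefficients on the simplices with `m` vertices. For `m = 0`
this is the copy of `ℤ` by which the simplicial chain complex is augmented. -/
abbrev Chains (m : ℕ) : Type _ := Flag P m →₀ ℤ

/-- The boundary map of the augmented simplicial chain complex,
`∂ (p 0 < ⋯ < p m) = ∑ i, (-1) ^ i • (p 0 < ⋯ < (p i omitted) < ⋯ < p m)`; it vanishes on the
empty simplex. -/
def boundary : (m : ℕ) → Chains P m →ₗ[ℤ] Chains P (m - 1)
  | 0 => 0
  | m + 1 => Finsupp.linearCombination ℤ
      fun p : Flag P (m + 1) => ∑ i : Fin (m + 1), (-1 : ℤ) ^ (i : ℕ) • Finsupp.single (p.face i) 1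

variable {P} in
lemma boundary_succ_single {m : ℕ} (p : Flag P (m + 1)) (c : ℤ) :
    boundary P (m + 1) (Finsupp.single p c) =
      c • ∑ i : Fin (m + 1), (-1 : ℤ) ^ (i : ℕ) • Finsupp.single (p.face i) 1 := by
  simp [boundary]

/-- Reduced cycles of dimension `m - 1`. -/
def cycles (m : ℕ) : Submodule ℤ (Chains P m) := LinearMap.ker (boundary P m)

/-- Boundaries of dimension `m - 1`. -/
def boundaries (m : ℕ) : Submodule ℤ (Chains P m) := LinearMap.range (boundary P (m + 1))

variable {P} in
lemma Flag.face_face {m : ℕ} (p : Flag P (m + 2)) (i j : Fin (m + 1)) (h : i ≤ j) :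
    (p.face j.succ).face i = (p.face i.castSucc).face j := by
  apply Subtype.ext
  funext k
  refine congrArg p.1 (Fin.ext ?_)
  simp only [Fin.succAbove, Fin.lt_def, Fin.le_def] at *
  grind

/-- Boundaries are cycles. -/
lemma boundaries_le_cycles (m : ℕ) : boundaries P m ≤ cycles P m := by
  rintro _ ⟨c, rfl⟩
  cases m with
  | zero => rfl
  | succ m =>
    change boundary P (m + 1) (boundary P (m + 2) c) = 0
    induction c using Finsupp.induction_linear with
    | zero => simp
    | add x y hx hy => simp only [map_add, hx, hy, add_zero]
    | single p c =>
      rw [boundary_succ_single, map_smul, map_sum]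
      simp only [map_smul]
      refine (congrArg (c • ·) ?_).trans (smul_zero c)
      have h1 : ∀ i : Fin (m + 2), boundary P (m + 1) (Finsupp.single (p.face i) 1) =
          ∑ j : Fin (m + 1), (-1 : ℤ) ^ (j : ℕ) • Finsupp.single ((p.face i).face j) 1 := by
        intro i
        rw [boundary_succ_single, one_smul]
      refine (Finset.sum_congr rfl fun i _ => congrArg _ (h1 i)).trans ?_
      simp only [Finset.smul_sum, smul_smul]
      rw [← Finset.sum_product']
      refine Finset.sum_involution (fun x _ => if h : (x.2 : ℕ) < x.1 then
          (⟨x.2, by omega⟩, ⟨x.1 - 1, by omega⟩) else (⟨x.2 + 1, by omega⟩, ⟨x.1, by omega⟩))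
        ?_ ?_ (fun _ _ => Finset.mem_univ _) ?_
      · rintro ⟨i, j⟩ -
        by_cases h : (j : ℕ) < i
        · have h2 := p.face_face j ⟨i - 1, by omega⟩ (by rw [Fin.le_def]; simp; omega)
          have h3 : (⟨i - 1, by omega⟩ : Fin (m + 1)).succ = i := Fin.ext (by simp; omega)
          rw [h3] at h2
          have h4 : (-1 : ℤ) ^ (i : ℕ) = -(-1) ^ ((i : ℕ) - 1) := by
            conv_lhs => rw [show (i : ℕ) = i - 1 + 1 by omega, pow_succ]
            ring
          have h5 : (⟨j, by omega⟩ : Fin (m + 2)) = j.castSucc := rfl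
          simp only [dif_pos h]
          rw [h2, h4, h5, ← add_smul]
          refine (congrArg (· • _) ?_).trans (zero_smul _ _)
          ring
        · have h2 := p.face_face ⟨i, by omega⟩ j (by rw [Fin.le_def]; simp; omega)
          simp only [dif_neg h]
          have h3 : (⟨j + 1, by omega⟩ : Fin (m + 2)) = j.succ := rfl
          have h4 : (⟨i, by omega⟩ : Fin (m + 1)).castSucc = i := rfl
          rw [h4] at h2
          rw [h3, h2, ← add_smul]
          refine (congrArg (· • _) ?_).trans (zero_smul _ _)
          ring
      · rintro ⟨i, j⟩ - -
        by_cases h : (j : ℕ) < i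
        · simp only [dif_pos h, ne_eq, Prod.mk.injEq, Fin.ext_iff]
          omega
        · simp only [dif_neg h, ne_eq, Prod.mk.injEq, Fin.ext_iff]
          omega
      · rintro ⟨i, j⟩ -
        by_cases h : (j : ℕ) < i
        · have h' : ¬ ((i : ℕ) - 1 < j) := by omega
          simp only [dif_pos h, dif_neg h', Prod.mk.injEq, Fin.ext_iff, and_true]
          omega
        · have h' : (i : ℕ) < j + 1 := by omega
          simp only [dif_neg h, dif_pos h', Prod.mk.injEq, Fin.ext_iff, true_and]
          omega

/-- The reduced simplicial homology group `H̃_{m-1}` (with integer coefficients) of the order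
complex of `P`: the index `m` is the number of vertices, hence one more than the dimension. -/
abbrev ReducedHomology (m : ℕ) : Type _ :=
  cycles P m ⧸ (boundaries P m).submoduleOf (cycles P m)

end OrderComplex

/-! ### Signed permutations -/

section SignedPerm

/-- The index set `{1, …, n, -n, …, -1}`: the pair `(i, 1)` stands for the index `i + 1`
and the pair `(i, -1)` for the index `-(i + 1)`. -/
abbrev SignedIndex (n : ℕ) : Type := Fin n × ℤˣ

/-- The map `i ↦ -i` on `{1, …, n, -n, …, -1}`. -/
def SignedIndex.opp {n : ℕ} (i : SignedIndex n) : SignedIndex n := (i.1, -i.2)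

/-- The group of signed permutations, i.e. of the permutations of `{1, …, n, -n, …, -1}` with
`σ (-i) = -σ i`, as a subgroup of the symmetric group. -/
def SignedPerm (n : ℕ) : Subgroup (Equiv.Perm (SignedIndex n)) where
  carrier := {σ | ∀ i, σ i.opp = (σ i).opp}
  mul_mem' {σ τ} hσ hτ i := by
    change σ (τ i.opp) = (σ (τ i)).opp
    rw [hτ, hσ]
  one_mem' i := rfl
  inv_mem' {σ} hσ i := by
    change σ⁻¹ i.opp = (σ⁻¹ i).opp
    apply σ.injective
    rw [hσ]
    simp

instance (n : ℕ) : Fintype (SignedPerm n) := Fintype.ofFinite _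

variable {n : ℕ}

/-- A permutation of `{1, …, n}`, extended to a signed permutation by `π (-i) = -π i`. -/
def liftPerm (π : Equiv.Perm (Fin n)) : SignedPerm n :=
  ⟨Equiv.prodCongrLeft fun _ => π, fun _ => rfl⟩

/-- The signed permutation that exchanges `i` and `-i` and fixes all other indices. -/
def negAt (i : Fin n) : SignedPerm n :=
  ⟨Equiv.swap (i, 1) (i, -1), by
    rintro ⟨j, ε⟩
    simp only [SignedIndex.opp, Equiv.swap_apply_def, Prod.mk.injEq]
    rcases Int.units_eq_one_or ε with rfl | rfl <;> by_cases h : j = i <;> simp [h]⟩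

/-- The simple reflections `s_1, …, s_n`: `s_i` exchanges `i` and `i + 1` (and `-i` and `-(i + 1)`)
for `i < n`, and `s_n` exchanges `n` and `-n`. -/
def simpleReflection (i : Fin n) : SignedPerm n :=
  if h : (i : ℕ) + 1 < n then liftPerm (Equiv.swap i ⟨i + 1, h⟩) else negAt i

/-- The word length of a signed permutation with respect to the simple reflections. -/
def len (σ : SignedPerm n) : ℕ :=
  sInf {l | ∃ w : List (Fin n), w.length = l ∧ (w.map simpleReflection).prod = σ}

/-- The permutation of `{1, …, n}` underlying a signed permutation, `i ↦ |σ i|`. -/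
def absPerm : SignedPerm n →* Equiv.Perm (Fin n) :=
  MonoidHom.toHomPerm
    { toFun := fun σ i => (σ.1 (i, 1)).1
      map_one' := rfl
      map_mul' := fun σ τ => by
        funext i
        change (σ.1 (τ.1 (i, 1))).1 = (σ.1 ((τ.1 (i, 1)).1, 1)).1
        generalize τ.1 (i, 1) = x
        obtain ⟨j, ε⟩ := x
        rcases Int.units_eq_one_or ε with rfl | rfl
        · rfl
        · have : σ.1 (j, -1) = (σ.1 (j, 1)).opp := σ.2 (j, 1)
          change (σ.1 (j, -1)).1 = (σ.1 (j, 1)).1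
          rw [this]
          rfl }

lemma absPerm_apply (σ : SignedPerm n) (i : Fin n) : absPerm σ i = (σ.1 (i, 1)).1 := rfl

/-- The sign character of the group of signed permutations. -/
def signHom : SignedPerm n →* ℤˣ :=
  (Equiv.Perm.sign.comp (SignedPerm n).subtype) * (Equiv.Perm.sign.comp absPerm)

lemma signHom_liftPerm (π : Equiv.Perm (Fin n)) : signHom (liftPerm π) = Equiv.Perm.sign π := by
  have h1 : absPerm (liftPerm π) = π := by
    ext i
    rfl
  have h2 : Equiv.Perm.sign (liftPerm π).1 = 1 := by
    refine (Equiv.Perm.sign_prodCongrLeft fun _ : ℤˣ => π).trans ?_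
    rw [Finset.prod_const]
    exact Int.units_sq _
  simp [signHom, h1, h2]

lemma signHom_negAt (i : Fin n) : signHom (negAt i) = -1 := by
  have h1 : absPerm (negAt i) = 1 := by
    ext j
    simp only [absPerm_apply, negAt, Equiv.swap_apply_def]
    split_ifs <;> simp_all
  have h2 : Equiv.Perm.sign (negAt i).1 = -1 :=
    Equiv.Perm.sign_swap fun h => by simpa using congrArg Prod.snd h
  simp [signHom, h1, h2]

lemma signHom_simpleReflection (i : Fin n) : signHom (simpleReflection i) = -1 := by
  unfold simpleReflection
  split_ifs with h
  · rw [signHom_liftPerm]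
    exact Equiv.Perm.sign_swap fun h' => by simpa using congrArg Fin.val h'
  · exact signHom_negAt i

lemma liftPerm_mul (π ρ : Equiv.Perm (Fin n)) : liftPerm (π * ρ) = liftPerm π * liftPerm ρ := rfl

lemma negAt_mul_negAt (i : Fin n) : negAt i * negAt i = 1 :=
  Subtype.ext (Equiv.swap_mul_self _ _)

lemma negAt_apply_of_ne (i j : Fin n) (h : j ≠ i) (ε : ℤˣ) : (negAt i).1 (j, ε) = (j, ε) :=
  Equiv.swap_apply_of_ne_of_ne (fun h' => h (congrArg Prod.fst h'))
    (fun h' => h (congrArg Prod.fst h'))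

lemma negAt_apply_self (i : Fin n) : (negAt i).1 (i, 1) = (i, -1) :=
  Equiv.swap_apply_left _ _

lemma closure_simpleReflection :
    Submonoid.closure (Set.range (simpleReflection (n := n))) = ⊤ := by
  set M := Submonoid.closure (Set.range (simpleReflection (n := n))) with hM
  have hlift : ∀ π : Equiv.Perm (Fin n), liftPerm π ∈ M := by
    intro π
    cases n with
    | zero =>
      rw [show liftPerm π = 1 from Subtype.ext (Subsingleton.elim _ _)]
      exact one_mem _
    | succ m =>
      have hπ : π ∈ Submonoid.closure
          (Set.range fun i : Fin m ↦ Equiv.swap i.castSucc i.succ) := by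
        rw [Equiv.Perm.mclosure_swap_castSucc_succ]
        trivial
      induction hπ using Submonoid.closure_induction with
      | mem x hx =>
        obtain ⟨i, rfl⟩ := hx
        have h : simpleReflection i.castSucc = liftPerm (Equiv.swap i.castSucc i.succ) := by
          unfold simpleReflection
          rw [dif_pos (by simp)]
          rfl
        change liftPerm (Equiv.swap i.castSucc i.succ) ∈ M
        rw [← h]
        exact Submonoid.subset_closure ⟨_, rfl⟩
      | one => exact one_mem _
      | mul x y _ _ hx hy =>
        rw [liftPerm_mul]
        exact mul_mem hx hy
  have hneg : ∀ i : Fin n, negAt i ∈ M := by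
    intro i
    have hl : n - 1 < n := by have := i.2; omega
    have hlast : negAt (⟨n - 1, hl⟩ : Fin n) ∈ M := by
      have h : simpleReflection (⟨n - 1, hl⟩ : Fin n) = negAt ⟨n - 1, hl⟩ := by
        unfold simpleReflection
        rw [dif_neg (by simp; omega)]
      rw [← h]
      exact Submonoid.subset_closure ⟨_, rfl⟩
    have h : negAt i = liftPerm (Equiv.swap i ⟨n - 1, hl⟩) * negAt ⟨n - 1, hl⟩ *
        liftPerm (Equiv.swap i ⟨n - 1, hl⟩) := by
      apply Subtype.ext
      ext1 x
      obtain ⟨j, ε⟩ := x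
      have hl' : ∀ (π : Equiv.Perm (Fin n)) y, (liftPerm π).1 y = (π y.1, y.2) := fun _ _ => rfl
      have hn' : ∀ (k : Fin n) y, (negAt k).1 y = if y.1 = k then (y.1, -y.2) else y := by
        rintro k ⟨y, δ⟩
        simp only [negAt, Equiv.swap_apply_def, Prod.mk.injEq]
        rcases Int.units_eq_one_or δ with rfl | rfl <;> by_cases h : y = k <;> simp [h]
      simp only [Subgroup.coe_mul, Equiv.Perm.mul_apply, hl', hn', Equiv.swap_apply_def]
      grind
    rw [h]
    exact mul_mem (mul_mem (hlift _) hlast) (hlift _)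
  refine eq_top_iff.2 fun σ _ => ?_
  induction hk : (Finset.univ.filter fun i : Fin n => (σ.1 (i, 1)).2 = -1).card
    using Nat.strong_induction_on generalizing σ with
  | _ k ih =>
    by_cases h : ∃ i : Fin n, (σ.1 (i, 1)).2 = -1
    · obtain ⟨i, hi⟩ := h
      have h1 : σ = σ * negAt i * negAt i := by rw [mul_assoc, negAt_mul_negAt, mul_one]
      rw [h1]
      refine mul_mem (ih _ ?_ (σ * negAt i) trivial rfl) (hneg i)
      rw [← hk]
      have h3 : (σ.1 (i, -1)).2 = 1 := by
        have : σ.1 (i, -1) = (σ.1 (i, 1)).opp := σ.2 (i, 1)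
        rw [this]
        simp [SignedIndex.opp, hi]
      refine Finset.card_lt_card ((Finset.ssubset_iff_of_subset ?_).2 ⟨i, by simp [hi], ?_⟩)
      · intro j hj
        have hj' : (σ.1 ((negAt i).1 (j, 1))).2 = -1 := (Finset.mem_filter.1 hj).2
        refine Finset.mem_filter.2 ⟨Finset.mem_univ _, ?_⟩
        by_cases hji : j = i
        · rwa [hji]
        · rwa [negAt_apply_of_ne i j hji] at hj'
      · intro hj
        have hj' : (σ.1 ((negAt i).1 (i, 1))).2 = -1 := (Finset.mem_filter.1 hj).2
        rw [negAt_apply_self, h3] at hj'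
        exact absurd hj' (by decide)
    · push Not at h
      have h1 : ∀ i, σ.1 (i, 1) = (absPerm σ i, 1) := fun i =>
        Prod.ext rfl ((Int.units_eq_one_or _).resolve_right (h i))
      have h2 : σ = liftPerm (absPerm σ) := by
        apply Subtype.ext
        ext1 x
        obtain ⟨j, ε⟩ := x
        rcases Int.units_eq_one_or ε with rfl | rfl
        · exact h1 j
        · have : σ.1 (j, -1) = (σ.1 (j, 1)).opp := σ.2 (j, 1)
          rw [this, h1]
          rfl
      rw [h2]
      exact hlift _

/-- Since the simple reflections generate, the length is attained by a word. -/
lemma exists_word (σ : SignedPerm n) :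
    ∃ w : List (Fin n), w.length = len σ ∧ (w.map simpleReflection).prod = σ := by
  refine Nat.sInf_mem (s := {l | ∃ w : List (Fin n), w.length = l ∧
    (w.map simpleReflection).prod = σ}) ?_
  have hσ : σ ∈ Submonoid.closure (Set.range (simpleReflection (n := n))) := by
    rw [closure_simpleReflection]
    trivial
  induction hσ using Submonoid.closure_induction with
  | mem x hx =>
    obtain ⟨i, rfl⟩ := hx
    exact ⟨1, [i], rfl, by simp⟩
  | one => exact ⟨0, [], rfl, rfl⟩
  | mul x y _ _ hx hy =>
    obtain ⟨_, w, -, hw⟩ := hx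
    obtain ⟨_, v, -, hv⟩ := hy
    exact ⟨_, w ++ v, rfl, by rw [List.map_append, List.prod_append, hw, hv]⟩

lemma neg_one_pow_len (σ : SignedPerm n) : (-1 : ℤˣ) ^ len σ = signHom σ := by
  obtain ⟨w, hw, hσ⟩ := exists_word σ
  rw [← hw, ← hσ]
  clear hw hσ
  induction w with
  | nil => simp
  | cons i w ih => simp [signHom_simpleReflection, pow_succ, ih]

end SignedPerm

/-! ### Symplectic forms, the building and its apartments -/

section Building

/-- A bilinear form `ω` on an `R`-module `M` is symplectic if it is alternating and non-degenerate,
where the latter means that `x ↦ ω x ·` and `y ↦ ω · y` are bijections from `M` to its dual. -/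
structure IsSymplecticForm {R M : Type*} [CommRing R] [AddCommGroup M] [Module R M]
    (ω : LinearMap.BilinForm R M) : Prop where
  alternating : ∀ x, ω x x = 0
  bijective_left : Function.Bijective fun x : M => (ω x : Module.Dual R M)
  bijective_right : Function.Bijective fun y : M => (ω.flip y : Module.Dual R M)

variable {K V : Type*} [Field K] [AddCommGroup V] [Module K V]

/-- A subspace is isotropic if the form vanishes identically on it. -/
def IsIsotropic (B : LinearMap.BilinForm K V) (U : Submodule K V) : Prop :=
  ∀ x ∈ U, ∀ y ∈ U, B x y = 0

/-- The poset of non-trivial isotropic subspaces, ordered by inclusion. Its order complex is the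
spherical building of the form. -/
abbrev IsotropicPoset (B : LinearMap.BilinForm K V) : Type _ :=
  {U : Submodule K V // U ≠ ⊥ ∧ IsIsotropic B U}

/-- A symplectic frame: one-dimensional subspaces `L_1, …, L_n, L_{-n}, …, L_{-1}`
such that `L_i + L_j` is isotropic if and only if `j ≠ -i`. -/
structure SymplecticFrame (B : LinearMap.BilinForm K V) (n : ℕ) where
  line : SignedIndex n → Submodule K V
  finrank_line : ∀ i, Module.finrank K (line i) = 1
  isotropic_iff : ∀ i j, IsIsotropic B (line i ⊔ line j) ↔ j ≠ i.opp

namespace SymplecticFrame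

variable {B : LinearMap.BilinForm K V} {n : ℕ} (L : SymplecticFrame B n)

/-- The subspace `L_{σ([k + 1])} = L_{σ(1)} + ⋯ + L_{σ(k + 1)}`, for `k = 0, …, n - 1`. -/
def span (σ : SignedPerm n) (k : Fin n) : Submodule K V :=
  ⨆ j : {j : Fin n // j ≤ k}, L.line (σ.1 (j.1, 1))

lemma apply_eq_zero {i j : SignedIndex n} (h : j ≠ i.opp) {x y : V} (hx : x ∈ L.line i)
    (hy : y ∈ L.line j) : B x y = 0 :=
  (L.isotropic_iff i j).2 h x (Submodule.mem_sup_left hx) y (Submodule.mem_sup_right hy)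

lemma apply_ne_opp (σ : SignedPerm n) (i j : Fin n) : σ.1 (j, 1) ≠ (σ.1 (i, 1)).opp := by
  intro h
  have h1 : σ.1 (i, -1) = (σ.1 (i, 1)).opp := σ.2 (i, 1)
  rw [← h1] at h
  have h2 : (1 : ℤˣ) = -1 := congrArg Prod.snd (σ.1.injective h)
  exact absurd h2 (by decide)

lemma isIsotropic_span (σ : SignedPerm n) (k : Fin n) : IsIsotropic B (L.span σ k) := by
  intro x hx y hy
  refine Submodule.iSup_induction _ (motive := fun x => B x y = 0) hx (fun i x hx => ?_)
    (by simp) (fun a b ha hb => by simp [ha, hb])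
  refine Submodule.iSup_induction _ (motive := fun y => B x y = 0) hy (fun j y hy => ?_)
    (by simp) (fun a b ha hb => by simp [ha, hb])
  exact L.apply_eq_zero (apply_ne_opp σ i.1 j.1) hx hy

lemma line_le_span (σ : SignedPerm n) {j k : Fin n} (h : j ≤ k) :
    L.line (σ.1 (j, 1)) ≤ L.span σ k :=
  le_iSup (fun j : {j // j ≤ k} => L.line (σ.1 (j.1, 1))) ⟨j, h⟩

lemma span_ne_bot (σ : SignedPerm n) (k : Fin n) : L.span σ k ≠ ⊥ := by
  intro h
  have h1 := L.line_le_span σ (le_refl k)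
  rw [h, le_bot_iff] at h1
  have h2 := L.finrank_line (σ.1 (k, 1))
  rw [h1, finrank_bot] at h2
  exact absurd h2 (by decide)

lemma opp_opp (i : SignedIndex n) : i.opp.opp = i := by simp [SignedIndex.opp]

lemma opp_ne (i : SignedIndex n) : i ≠ i.opp := by
  intro h
  have h2 : i.2 = -i.2 := congrArg Prod.snd h
  rcases Int.units_eq_one_or i.2 with h3 | h3 <;> rw [h3] at h2 <;> exact absurd h2 (by decide)

lemma strictMono_span (σ : SignedPerm n) : StrictMono (L.span σ) := by
  intro k l hkl
  refine lt_of_le_of_ne (iSup_le fun j => L.line_le_span σ (j.2.trans hkl.le)) fun he => ?_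
  set i := σ.1 (l, 1) with hi
  have h1 : L.line i ≤ L.span σ k := by
    rw [he]
    exact L.line_le_span σ le_rfl
  have hne : ∀ j : {j : Fin n // j ≤ k}, σ.1 (j.1, 1) ≠ i := by
    intro j h
    have h2 : j.1 = l := congrArg Prod.fst (σ.1.injective h)
    exact absurd (h2 ▸ j.2) (not_le.2 hkl)
  have hl : ∀ x ∈ L.span σ k, ∀ y ∈ L.line i.opp, B x y = 0 := by
    intro x hx y hy
    refine Submodule.iSup_induction _ (motive := fun x => B x y = 0) hx (fun j x hx => ?_)
      (by simp) (fun a b ha hb => by simp [ha, hb])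
    refine L.apply_eq_zero (fun h => hne j ?_) hx hy
    rw [← opp_opp (σ.1 (j.1, 1)), ← h, opp_opp]
  have hr : ∀ x ∈ L.span σ k, ∀ y ∈ L.line i.opp, B y x = 0 := by
    intro x hx y hy
    refine Submodule.iSup_induction _ (motive := fun x => B y x = 0) hx (fun j x hx => ?_)
      (by simp) (fun a b ha hb => by simp [ha, hb])
    refine L.apply_eq_zero (fun h => hne j ?_) hy hx
    rw [h, opp_opp]
  refine (L.isotropic_iff i i.opp).1 ?_ rfl
  intro x hx y hy
  obtain ⟨a, ha, b, hb, rfl⟩ := Submodule.mem_sup.1 hx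
  obtain ⟨c, hc, d, hd, rfl⟩ := Submodule.mem_sup.1 hy
  simp only [map_add, LinearMap.add_apply]
  rw [L.apply_eq_zero (opp_ne i) ha hc, L.apply_eq_zero (opp_ne i.opp) hb hd,
    hl a (h1 ha) d hd, hr c (h1 hc) b hb]
  simp

/-- The chain `L_{σ([1])} ⊂ ⋯ ⊂ L_{σ([n])}` of isotropic subspaces. -/
def chamber (σ : SignedPerm n) : Flag (IsotropicPoset B) n :=
  ⟨fun k => ⟨L.span σ k, L.span_ne_bot σ k, L.isIsotropic_span σ k⟩, L.strictMono_span σ⟩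

/-- The chain `∑ σ, (-1) ^ len σ • (L_{σ([1])} ⊂ ⋯ ⊂ L_{σ([n])})`, where `σ` runs through the
signed permutations. -/
def apartmentChain : Chains (IsotropicPoset B) n :=
  ∑ σ : SignedPerm n, (-1 : ℤ) ^ len σ • Finsupp.single (L.chamber σ) 1

/-- Two chambers of an apartment that differ by a simple reflection share a face. -/
lemma face_chamber_mul {m : ℕ} (L : SymplecticFrame B (m + 1)) (σ : SignedPerm (m + 1))
    (i : Fin (m + 1)) : (L.chamber (σ * simpleReflection i)).face i = (L.chamber σ).face i := by
  apply Subtype.ext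
  funext k
  apply Subtype.ext
  change L.span _ (i.succAbove k) = L.span _ (i.succAbove k)
  have hk : i.succAbove k ≠ i := Fin.succAbove_ne i k
  generalize i.succAbove k = l at hk
  have hle : ∀ τ ρ : SignedPerm (m + 1), (∀ j ≤ l, ∃ j' ≤ l, τ.1 (j, 1) = ρ.1 (j', 1)) →
      L.span τ l ≤ L.span ρ l := by
    intro τ ρ h
    refine iSup_le fun j => ?_
    obtain ⟨j', hj', e⟩ := h j.1 j.2
    rw [e]
    exact le_iSup (fun j : {j // j ≤ l} => L.line (ρ.1 (j.1, 1))) ⟨j', hj'⟩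
  have hs : ∀ j ≤ l, ∃ j' ≤ l, (simpleReflection i).1 (j, 1) = (j', 1) := by
    intro j hj
    unfold simpleReflection
    split_ifs with h
    · refine ⟨Equiv.swap i ⟨i + 1, h⟩ j, ?_, rfl⟩
      rw [Equiv.swap_apply_def]
      split_ifs with h1 h2 <;> simp only [Fin.le_def, Fin.ext_iff, ne_eq] at * <;> omega
    · refine ⟨j, hj, negAt_apply_of_ne i j ?_ 1⟩
      have := l.2
      simp only [Fin.le_def, Fin.ext_iff, ne_eq] at *
      omega
  have hinv : simpleReflection i * simpleReflection i = 1 := by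
    unfold simpleReflection
    split_ifs with h
    · rw [← liftPerm_mul, Equiv.swap_mul_self]
      rfl
    · exact negAt_mul_negAt i
  refine le_antisymm (hle _ _ fun j hj => ?_) (hle _ _ fun j hj => ?_)
  · obtain ⟨j', hj', e⟩ := hs j hj
    exact ⟨j', hj', congrArg σ.1 e⟩
  · obtain ⟨j', hj', e⟩ := hs j hj
    refine ⟨j', hj', ?_⟩
    change _ = σ.1 ((simpleReflection i).1 (j', 1))
    rw [← e]
    have h2 : (simpleReflection i).1 ((simpleReflection i).1 (j, 1)) = (j, 1) :=
      congrArg (fun τ : SignedPerm (m + 1) => τ.1 (j, 1)) hinv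
    rw [h2]

lemma apartmentChain_mem_cycles : L.apartmentChain ∈ cycles (IsotropicPoset B) n := by
  cases n with
  | zero => rfl
  | succ m =>
    change boundary _ (m + 1) L.apartmentChain = 0
    unfold apartmentChain
    rw [map_sum]
    simp only [map_smul, boundary_succ_single, one_smul]
    simp only [Finset.smul_sum]
    refine Finset.sum_comm.trans (Finset.sum_eq_zero fun i _ => ?_)
    have hlen : ∀ σ : SignedPerm (m + 1),
        (-1 : ℤ) ^ len (σ * simpleReflection i) = -(-1) ^ len σ := by
      intro σ
      have h : (-1 : ℤˣ) ^ len (σ * simpleReflection i) = -(-1) ^ len σ := by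
        rw [neg_one_pow_len, neg_one_pow_len, map_mul, signHom_simpleReflection, mul_neg_one]
      simpa using congrArg (Units.val : ℤˣ → ℤ) h
    refine self_eq_neg.1 ?_
    rw [← Finset.sum_neg_distrib]
    refine (Equiv.sum_comp (Equiv.mulRight (simpleReflection i)) _).symm.trans
      (Finset.sum_congr rfl fun σ _ => ?_)
    simp only [Equiv.coe_mulRight, hlen, face_chamber_mul, neg_smul]

/-- The apartment class `[Σ_L]` in the reduced homology of the building. -/
def apartmentClass : ReducedHomology (IsotropicPoset B) n :=
  Submodule.Quotient.mk ⟨L.apartmentChain, L.apartmentChain_mem_cycles⟩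

end SymplecticFrame

end Building

/-! ### Forms and frames over the fraction field -/

section Integrality

variable {R : Type*} [CommRing R] (K : Type*) [Field K] [Algebra R K] {n : ℕ}

/-- The `K`-bilinear form on `K ^ (2 n)` induced by an `R`-bilinear form on `R ^ (2 n)`, i.e. the
one with the same Gram matrix with respect to the standard bases. -/
def extendForm (ω : LinearMap.BilinForm R (Fin (2 * n) → R)) :
    LinearMap.BilinForm K (Fin (2 * n) → K) :=
  Matrix.toBilin' ((LinearMap.BilinForm.toMatrix' ω).map (algebraMap R K))

/-- The coordinatewise map `R ^ (2 n) → K ^ (2 n)`. -/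
def latticeMap (R : Type*) [CommRing R] [Algebra R K] (n : ℕ) :
    (Fin (2 * n) → R) →ₗ[R] (Fin (2 * n) → K) :=
  (Algebra.linearMap R K).compLeft (Fin (2 * n))

/-- The induced form extends the given one. -/
lemma extendForm_latticeMap (ω : LinearMap.BilinForm R (Fin (2 * n) → R)) (x y : Fin (2 * n) → R) :
    extendForm K ω (latticeMap K R n x) (latticeMap K R n y) = algebraMap R K (ω x y) := by
  have h : ω x y = Matrix.toBilin' (LinearMap.BilinForm.toMatrix' ω) x y := by
    rw [Matrix.toBilin'_toMatrix']
  rw [h, Matrix.toBilin'_apply]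
  simp [extendForm, latticeMap, Matrix.toBilin'_apply]

/-- The symplectic Steinberg module `H̃_{n-1}` of the building of isotropic subspaces
of `K ^ (2 n)`. -/
abbrev SteinbergModule (ω : LinearMap.BilinForm R (Fin (2 * n) → R)) : Type _ :=
  ReducedHomology (IsotropicPoset (extendForm K ω)) n

variable {K}

/-- A symplectic frame of `K ^ (2 n)` is integral if `R ^ (2 n)` is the (internal) direct sum of the
intersections `L_i ∩ R ^ (2 n)`. -/
def SymplecticFrame.IsIntegral {ω : LinearMap.BilinForm R (Fin (2 * n) → R)}
    (L : SymplecticFrame (extendForm K ω) n) : Prop :=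
  DirectSum.IsInternal fun i : SignedIndex n =>
    ((L.line i).restrictScalars R).comap (latticeMap K R n)

end Integrality

end SymplecticSteinberg

end

/-! Write Λ for the lattice R^{2n} in K^{2n}. A full isotropic flag U_1 ⊂ … ⊂ U_n has graded pieces
(U_k ∩ Λ)/(U_{k-1} ∩ Λ), which are projective R-modules of rank one; call the flag free if all of
them are free. As Λ is self-dual, a piece is free exactly when some v ∈ U_k pairs Λ ∩ U_{k-1}^⊥ onto
R, and this is the form used in `IsFreeStep`. No isotropic flag has n + 1 members, so the top
homology is the group of cycles and every function on n-step flags gives a functional on the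
Steinberg module (`exists_functional`). The functional used counts free flags.

It kills integral apartments. There Λ splits along the frame, so freeness of a step depends only on
the line that is added (`Decomposes.isFreeStep_iff`), and the pieces at L_i and L_{-i} are dual to
each other, hence free together (`Decomposes.isFreeLine_opp`). So all chambers are free or none is,
and the signs cancel.

It does not kill every apartment. Λ has a symplectic basis e_m, f_m (`exists_symplecticSequence`).
Since R is not principal, there is r with R + Rr non-principal (`exists_sup_span_ne`). Take the
lines of e_m + r e_{m+1}, where e_n = 0, and dual vectors g_m, corrected by multiples of e_m so that
B(g_m, Λ) is non-principal (`exists_dualSequence`). By decreasing m, the former span the flag of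
e_{n-1}, e_{n-2}, …, which is free. At the first place where another chamber departs from it, the
new piece has value module R + Rr or B(g_m, Λ) up to scaling, so it is not free. The functional
therefore takes the value ±1 on this apartment (`freeFlagCount_dualFrame`). -/

noncomputable section

namespace SymplecticSteinberg

/-! ### Self-dual lattices and ideals of a Dedekind domain -/

section Lattice

variable {R K V : Type*} [CommRing R] [Field K] [Algebra R K] [AddCommGroup V] [Module K V]
  [Module R V]

/-- A self-dual lattice with respect to an alternating form over the fraction field. -/
structure IsSelfDualLattice (B : LinearMap.BilinForm K V) (Λ : Submodule R V) : Prop where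
  alternating : ∀ x, B x x = 0
  integral : ∀ x ∈ Λ, ∀ y ∈ Λ, B x y ∈ (1 : Submodule R K)
  selfDual : ∀ v, (∀ x ∈ Λ, B v x ∈ (1 : Submodule R K)) → v ∈ Λ
  nondegenerate : ∀ v, (∀ x ∈ Λ, B v x = 0) → v = 0
  exists_smul_mem : ∀ v : V, ∃ d : R, d ≠ 0 ∧ d • v ∈ Λ
  fg : Λ.FG

lemma IsSelfDualLattice.neg_eq {B : LinearMap.BilinForm K V} {Λ : Submodule R V}
    (h : IsSelfDualLattice B Λ) (x y : V) : B x y = -B y x := by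
  have h1 := h.alternating (x + y)
  simp only [map_add, LinearMap.add_apply, h.alternating, zero_add, add_zero] at h1
  exact eq_neg_of_add_eq_zero_right h1

variable [IsScalarTower R K V]

/-- The module of values of the pairing of a vector with a lattice. -/
def content (B : LinearMap.BilinForm K V) (Λ : Submodule R V) (v : V) : Submodule R K :=
  Λ.map ((B v).restrictScalars R)

lemma mem_content {B : LinearMap.BilinForm K V} {Λ : Submodule R V} {v : V} {t : K} :
    t ∈ content B Λ v ↔ ∃ x ∈ Λ, B v x = t := Iff.rfl

lemma smul_mem_of_mem_one {a : K} (ha : a ∈ (1 : Submodule R K)) {Λ : Submodule R V} {x : V}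
    (hx : x ∈ Λ) : a • x ∈ Λ := by
  obtain ⟨r, rfl⟩ := Submodule.mem_one.1 ha
  rw [algebraMap_smul]
  exact Λ.smul_mem r hx

variable [IsDedekindDomain R] [IsFractionRing R K]

/-- The elements `a`, `y` generate the ideal, and `x`, `b` lie in the inverse ideal. -/
lemma exists_mul_add_mul_eq_one {I : Ideal R} (hI : I ≠ ⊥) :
    ∃ a ∈ I, ∃ y ∈ I, ∃ x b : K, (∀ c ∈ I, algebraMap R K c * x ∈ (1 : Submodule R K)) ∧
      (∀ c ∈ I, algebraMap R K c * b ∈ (1 : Submodule R K)) ∧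
      algebraMap R K a * x + algebraMap R K y * b = 1 := by
  obtain ⟨a, ha, ha0⟩ := Submodule.exists_mem_ne_zero_of_ne_bot hI
  obtain ⟨y, hy⟩ := IsDedekindDomain.exists_sup_span_eq (I := Ideal.span {a}) (J := I)
    ((Ideal.span_singleton_le_iff_mem _).2 ha) (by simpa using ha0)
  -- 1 lies in I I⁻¹, and since I = (a, y) every element of this product has the form a x + y b with
  -- x, b ∈ I⁻¹.
  have h1 : (1 : K) ∈ ((I : FractionalIdeal (nonZeroDivisors R) K) *
      (I : FractionalIdeal (nonZeroDivisors R) K)⁻¹) := by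
    rw [FractionalIdeal.coe_ideal_mul_inv I hI]
    exact FractionalIdeal.one_mem_one _
  have hinv : ∀ x ∈ (I : FractionalIdeal (nonZeroDivisors R) K)⁻¹,
      ∀ c ∈ I, algebraMap R K c * x ∈ (1 : Submodule R K) := by
    intro x hx c hc
    have h2 := (FractionalIdeal.mem_inv_iff (by simpa using hI)).1 hx _
      (FractionalIdeal.mem_coeIdeal_of_mem (nonZeroDivisors R) hc)
    rw [mul_comm]
    obtain ⟨r, hr⟩ := (FractionalIdeal.mem_one_iff _).1 h2
    exact Submodule.mem_one.2 ⟨r, hr⟩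
  have h3 : ∀ t ∈ ((I : FractionalIdeal (nonZeroDivisors R) K) *
      (I : FractionalIdeal (nonZeroDivisors R) K)⁻¹),
      ∃ x ∈ (I : FractionalIdeal (nonZeroDivisors R) K)⁻¹,
      ∃ b ∈ (I : FractionalIdeal (nonZeroDivisors R) K)⁻¹,
        algebraMap R K a * x + algebraMap R K y * b = t := by
    intro t ht
    refine FractionalIdeal.mul_induction_on ht (fun i hi j hj => ?_) fun s t hs ht => ?_
    · obtain ⟨c, hc, rfl⟩ := (FractionalIdeal.mem_coeIdeal _).1 hi
      rw [← hy, Ideal.mem_span_singleton_sup] at hc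
      obtain ⟨p, q, hq, rfl⟩ := hc
      obtain ⟨q, rfl⟩ := Ideal.mem_span_singleton'.1 hq
      refine ⟨p • j, Submodule.smul_mem (I : FractionalIdeal (nonZeroDivisors R) K)⁻¹.1 p hj,
        q • j, Submodule.smul_mem (I : FractionalIdeal (nonZeroDivisors R) K)⁻¹.1 q hj, ?_⟩
      simp only [Algebra.smul_def, map_add, map_mul]
      ring
    · obtain ⟨x, hx, b, hb, rfl⟩ := hs
      obtain ⟨x', hx', b', hb', rfl⟩ := ht
      exact ⟨x + x', Submodule.add_mem _ hx hx', b + b', Submodule.add_mem _ hb hb', by ring⟩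
  obtain ⟨x, hx, b, hb, h⟩ := h3 1 h1
  refine ⟨a, ha, y, ?_, x, b, hinv x hx, hinv b hb, h⟩
  rw [← hy]
  exact Submodule.mem_sup_right (Ideal.mem_span_singleton_self y)

/-- If `R` is not a principal ideal domain, every non-zero finitely generated submodule of `K`
becomes non-principal after adjoining a suitable element. -/
lemma exists_sup_span_ne {I : Ideal R} (hI : ¬ I.IsPrincipal) {J : Submodule R K}
    (hJ : J.FG) (hJ0 : J ≠ ⊥) : ∃ s : K, ∀ t : K, J ⊔ R ∙ s ≠ R ∙ t := by
  have hI0 : I ≠ ⊥ := by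
    rintro rfl
    exact hI bot_isPrincipal
  obtain ⟨a, ha, ha0⟩ := Submodule.exists_mem_ne_zero_of_ne_bot hI0
  obtain ⟨F, rfl⟩ := hJ
  obtain ⟨d, hd⟩ := IsLocalization.exist_integer_multiples_of_finset (nonZeroDivisors R) F
  have hinj := IsFractionRing.injective R K
  have hd0 : (d : R) ≠ 0 := nonZeroDivisors.coe_ne_zero d
  -- d clears the denominators of J, and the factor a ∈ I then moves J into I.
  obtain ⟨e, he⟩ : ∃ e : R, e = a * d := ⟨_, rfl⟩
  have he0 : algebraMap R K e ≠ 0 := by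
    rw [Ne, map_eq_zero_iff _ hinj, he]
    exact mul_ne_zero ha0 hd0
  have hJe : ∀ x ∈ Submodule.span R (F : Set K), ∃ c ∈ I, algebraMap R K c =
      algebraMap R K e * x := by
    intro x hx
    induction hx using Submodule.span_induction with
    | mem x hx =>
      obtain ⟨r, hr⟩ := hd x hx
      refine ⟨a * r, I.mul_mem_right _ ha, ?_⟩
      rw [map_mul, hr, he, map_mul, Algebra.smul_def, mul_assoc]
    | zero => exact ⟨0, I.zero_mem, by simp⟩
    | add x y _ _ hx hy =>
      obtain ⟨c, hc, h⟩ := hx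
      obtain ⟨c', hc', h'⟩ := hy
      exact ⟨c + c', I.add_mem hc hc', by rw [map_add, h, h', mul_add]⟩
    | smul r x _ hx =>
      obtain ⟨c, hc, h⟩ := hx
      exact ⟨r * c, I.mul_mem_left _ hc, by rw [map_mul, h, Algebra.smul_def]; ring⟩
  -- J' is eJ, viewed as an ideal contained in I.
  set J' : Ideal R := (Submodule.span R (F : Set K)).comap
    (LinearMap.toSpanSingleton R K (algebraMap R K e)⁻¹) with hJ'
  have hmem : ∀ c, c ∈ J' ↔ algebraMap R K c * (algebraMap R K e)⁻¹ ∈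
      Submodule.span R (F : Set K) := by
    intro c
    rw [hJ', Submodule.mem_comap, LinearMap.toSpanSingleton_apply, Algebra.smul_def]
  have hJI : J' ≤ I := by
    intro c hc
    obtain ⟨c', hc', h⟩ := hJe _ ((hmem c).1 hc)
    rw [mul_comm, inv_mul_cancel_right₀ he0] at h
    rwa [← hinj h]
  have hJ'0 : J' ≠ 0 := by
    obtain ⟨x, hx, hx0⟩ := Submodule.exists_mem_ne_zero_of_ne_bot hJ0
    obtain ⟨c, -, h⟩ := hJe x hx
    intro h0
    have hc : c ∈ J' := by
      rw [hmem, h, mul_comm, inv_mul_cancel_left₀ he0]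
      exact hx
    rw [h0] at hc
    have hc0 : c = 0 := hc
    rw [hc0, map_zero] at h
    exact (mul_ne_zero he0 hx0) h.symm
  obtain ⟨c, hc⟩ := IsDedekindDomain.exists_sup_span_eq hJI hJ'0
  -- From I = eJ + (c) follows J + R(c/e) = e⁻¹I. If this were R t, then I would be generated by e
  -- t.
  refine ⟨algebraMap R K c * (algebraMap R K e)⁻¹, fun t ht => hI ?_⟩
  have hcI : c ∈ I := by
    rw [← hc]
    exact Submodule.mem_sup_right (Ideal.mem_span_singleton_self c)
  have hIt : ∀ b, b ∈ I ↔ ∃ q : R, algebraMap R K b = algebraMap R K q * (algebraMap R K e * t) := by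
    intro b
    constructor
    · intro hb
      rw [← hc] at hb
      obtain ⟨p, hp, q, hq, rfl⟩ := Submodule.mem_sup.1 hb
      obtain ⟨q, rfl⟩ := Ideal.mem_span_singleton'.1 hq
      have h1 : algebraMap R K (p + q * c) * (algebraMap R K e)⁻¹ ∈ R ∙ t := by
        rw [← ht, map_add, map_mul, add_mul, mul_assoc, ← Algebra.smul_def q]
        exact Submodule.add_mem_sup ((hmem p).1 hp)
          (Submodule.smul_mem _ _ (Submodule.mem_span_singleton_self _))
      obtain ⟨q', hq'⟩ := Submodule.mem_span_singleton.1 h1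
      refine ⟨q', ?_⟩
      rw [Algebra.smul_def, eq_mul_inv_iff_mul_eq₀ he0] at hq'
      rw [← hq']
      ring
    · rintro ⟨q, hq⟩
      have h1 : q • t ∈ R ∙ t := Submodule.smul_mem _ _ (Submodule.mem_span_singleton_self _)
      rw [← ht] at h1
      obtain ⟨x, hx, y, hy, hxy⟩ := Submodule.mem_sup.1 h1
      obtain ⟨z, rfl⟩ := Submodule.mem_span_singleton.1 hy
      obtain ⟨x', hx', hx''⟩ := hJe x hx
      have h2 : b = x' + z * c := by
        apply hinj
        rw [map_add, map_mul, hq, hx'']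
        rw [Algebra.smul_def, Algebra.smul_def] at hxy
        rw [mul_left_comm, ← hxy]
        field_simp
      rw [h2]
      exact I.add_mem hx' (I.mul_mem_left _ hcI)
  have ht1 : ∃ g : R, algebraMap R K g = algebraMap R K e * t := by
    have h1 : t ∈ R ∙ t := Submodule.mem_span_singleton_self t
    rw [← ht] at h1
    obtain ⟨x, hx, y, hy, rfl⟩ := Submodule.mem_sup.1 h1
    obtain ⟨z, rfl⟩ := Submodule.mem_span_singleton.1 hy
    obtain ⟨x', hx', hx''⟩ := hJe x hx
    refine ⟨x' + z * c, ?_⟩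
    rw [map_add, map_mul, hx'', Algebra.smul_def]
    field_simp
  obtain ⟨g, hg⟩ := ht1
  refine ⟨⟨g, ?_⟩⟩
  ext b
  rw [hIt, Submodule.mem_span_singleton]
  refine exists_congr fun q => ?_
  rw [← hg, ← map_mul, hinj.eq_iff, smul_eq_mul]
  exact eq_comm

end Lattice

/-! ### Symplectic bases of self-dual lattices -/

section Basis

variable {R K V : Type*} [CommRing R] [Field K] [Algebra R K] [AddCommGroup V] [Module K V]
  [Module R V]

/-- A partial symplectic basis of length `k`, contained in a lattice and extended by zero. -/
structure IsSymplecticSequence (B : LinearMap.BilinForm K V) (Λ : Submodule R V) (k : ℕ)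
    (e f : ℕ → V) : Prop where
  left_mem : ∀ i, e i ∈ Λ
  right_mem : ∀ i, f i ∈ Λ
  left_left : ∀ i j, B (e i) (e j) = 0
  right_right : ∀ i j, B (f i) (f j) = 0
  left_right_ne : ∀ i j, i ≠ j → B (e i) (f j) = 0
  left_right : ∀ i < k, B (e i) (f i) = 1
  left_zero : ∀ i, k ≤ i → e i = 0
  right_zero : ∀ i, k ≤ i → f i = 0

variable {B : LinearMap.BilinForm K V} {Λ : Submodule R V}

lemma IsSymplecticSequence.right_left_ne {k : ℕ} {e f : ℕ → V}
    (h : IsSymplecticSequence B Λ k e f) (hΛ : IsSelfDualLattice B Λ) (i j : ℕ) (hij : i ≠ j) :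
    B (f i) (e j) = 0 := by
  rw [hΛ.neg_eq, h.left_right_ne j i hij.symm, neg_zero]

lemma IsSymplecticSequence.right_left {k : ℕ} {e f : ℕ → V}
    (h : IsSymplecticSequence B Λ k e f) (hΛ : IsSelfDualLattice B Λ) (i : ℕ) (hi : i < k) :
    B (f i) (e i) = -1 := by
  rw [hΛ.neg_eq, h.left_right i hi]

variable [IsScalarTower R K V]

/-- The projection of a lattice vector to the complement of a symplectic sequence. -/
lemma IsSymplecticSequence.exists_orthogonal {k : ℕ} {e f : ℕ → V}
    (h : IsSymplecticSequence B Λ k e f) (hΛ : IsSelfDualLattice B Λ) {x : V} (hx : x ∈ Λ) :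
    ∃ x' ∈ Λ, (∀ i, B (e i) x' = 0 ∧ B (f i) x' = 0) ∧
      ∀ v, (∀ i, B (e i) v = 0 ∧ B (f i) v = 0) → B v x' = B v x := by
  refine ⟨x - ∑ i ∈ Finset.range k, (B (e i) x • f i - B (f i) x • e i), ?_, ?_, ?_⟩
  · refine Λ.sub_mem hx (Λ.sum_mem fun i _ => Λ.sub_mem ?_ ?_)
    · exact smul_mem_of_mem_one (hΛ.integral _ (h.left_mem i) _ hx) (h.right_mem i)
    · exact smul_mem_of_mem_one (hΛ.integral _ (h.right_mem i) _ hx) (h.left_mem i)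
  · intro i
    by_cases hi : i < k
    · simp only [map_sub, map_sum, map_smul, h.left_left, h.right_right, smul_zero, sub_zero,
        zero_sub]
      rw [Finset.sum_eq_single i, Finset.sum_eq_single i, h.left_right i hi,
        h.right_left hΛ i hi]
      · simp
      · intro j _ hj
        rw [h.right_left_ne hΛ i j hj.symm, smul_zero, neg_zero]
      · intro hi'
        exact absurd (Finset.mem_range.2 hi) hi'
      · intro j _ hj
        rw [h.left_right_ne i j hj.symm, smul_zero]
      · intro hi'
        exact absurd (Finset.mem_range.2 hi) hi'
    · rw [h.left_zero i (not_lt.1 hi), h.right_zero i (not_lt.1 hi)]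
      simp
  · intro v hv
    have h1 : ∀ i, B v (e i) = 0 := fun i => by rw [hΛ.neg_eq, (hv i).1, neg_zero]
    have h2 : ∀ i, B v (f i) = 0 := fun i => by rw [hΛ.neg_eq, (hv i).2, neg_zero]
    simp [h1, h2]

variable [IsDedekindDomain R] [IsFractionRing R K]

/-- A non-zero vector orthogonal to a symplectic sequence yields a hyperbolic pair of lattice
vectors orthogonal to it. -/
lemma IsSymplecticSequence.exists_pair {k : ℕ} {e f : ℕ → V}
    (h : IsSymplecticSequence B Λ k e f) (hΛ : IsSelfDualLattice B Λ) {v : V} (hv0 : v ≠ 0)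
    (hv : ∀ i, B (e i) v = 0 ∧ B (f i) v = 0) :
    ∃ p ∈ Λ, ∃ q ∈ Λ, (∀ i, B (e i) p = 0 ∧ B (f i) p = 0) ∧
      (∀ i, B (e i) q = 0 ∧ B (f i) q = 0) ∧ B p q = 1 := by
  have hinj := IsFractionRing.injective R K
  wlog hvΛ : v ∈ Λ generalizing v
  · obtain ⟨d, hd0, hd⟩ := hΛ.exists_smul_mem v
    have hd0' : algebraMap R K d ≠ 0 := by rwa [Ne, map_eq_zero_iff _ hinj]
    rw [← algebraMap_smul K] at hd
    refine this (smul_ne_zero hd0' hv0) (fun i => ?_) hd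
    simp [(hv i).1, (hv i).2]
  -- I = B(v, Λ) need not be principal, so v itself need not extend to a hyperbolic pair in Λ.
  set I : Ideal R := (content B Λ v).comap (Algebra.linearMap R K) with hIdef
  have hI : ∀ c, c ∈ I ↔ ∃ x ∈ Λ, B v x = algebraMap R K c := fun c => Iff.rfl
  have hI0 : I ≠ ⊥ := by
    intro h0
    refine hv0 (hΛ.nondegenerate v fun x hx => ?_)
    obtain ⟨c, hc⟩ := Submodule.mem_one.1 (hΛ.integral v hvΛ x hx)
    have hcI : c ∈ I := (hI c).2 ⟨x, hx, hc.symm⟩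
    rw [h0, Submodule.mem_bot] at hcI
    rw [← hc, hcI, map_zero]
  obtain ⟨a, ha, y, hy, s, b, hs, hb, hab⟩ := exists_mul_add_mul_eq_one (K := K) hI0
  obtain ⟨p', hp', hap'⟩ := (hI a).1 ha
  obtain ⟨q', hq', hyq'⟩ := (hI y).1 hy
  obtain ⟨p, hp, hpo, hpv⟩ := h.exists_orthogonal hΛ hp'
  obtain ⟨q, hq, hqo, hqv⟩ := h.exists_orthogonal hΛ hq'
  have hap : B v p = algebraMap R K a := (hpv v hv).trans hap'
  have hyq : B v q = algebraMap R K y := (hqv v hv).trans hyq'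
  set w := s • p + b • q with hw
  have hvw : B v w = 1 := by
    rw [hw, map_add, map_smul, map_smul, hap, hyq, ← hab, smul_eq_mul, smul_eq_mul]
    ring
  have hwv : B w v = -1 := by rw [hΛ.neg_eq, hvw]
  have hwo : ∀ i, B (e i) w = 0 ∧ B (f i) w = 0 := by
    intro i
    simp [hw, hpo, hqo]
  have hwΛ : ∀ c ∈ I, algebraMap R K c • w ∈ Λ := by
    intro c hc
    rw [hw, smul_add, smul_smul, smul_smul]
    exact Λ.add_mem (smul_mem_of_mem_one (hs c hc) hp) (smul_mem_of_mem_one (hb c hc) hq)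
  have hvΛ' : ∀ t : K, (∀ c ∈ I, algebraMap R K c * t ∈ (1 : Submodule R K)) → t • v ∈ Λ := by
    intro t ht
    refine hΛ.selfDual _ fun x hx => ?_
    obtain ⟨c, hc⟩ := Submodule.mem_one.1 (hΛ.integral v hvΛ x hx)
    rw [map_smul, LinearMap.smul_apply, ← hc, smul_eq_mul, mul_comm]
    exact ht c ((hI c).2 ⟨x, hx, hc.symm⟩)
  -- Λ contains I⁻¹v + Iw, with B(v, w) = 1. As in Steinitz' isomorphism I⁻¹ ⊕ I ≅ R², the
  -- coefficient matrix with rows (s, y) and (-b, a) has determinant as + yb = 1, so the new pair is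
  -- again hyperbolic.
  refine ⟨s • v + algebraMap R K y • w, Λ.add_mem (hvΛ' s hs) (hwΛ y hy),
    algebraMap R K a • w - b • v, Λ.sub_mem (hwΛ a ha) (hvΛ' b hb), fun i => ?_, fun i => ?_, ?_⟩
  · simp [hv, hwo]
  · simp [hv, hwo]
  · simp only [map_add, map_sub, map_smul, LinearMap.add_apply, LinearMap.smul_apply,
      hΛ.alternating, hvw, hwv, smul_eq_mul]
    linear_combination hab

/-- While k < n, the 2k conditions of orthogonality to the sequence have a non-zero solution in
dimension 2n, and `IsSymplecticSequence.exists_pair` turns it into the next hyperbolic pair. -/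
lemma exists_symplecticSequence [FiniteDimensional K V] (hΛ : IsSelfDualLattice B Λ) {n : ℕ}
    (hn : Module.finrank K V = 2 * n) (k : ℕ) (hk : k ≤ n) :
    ∃ e f : ℕ → V, IsSymplecticSequence B Λ k e f := by
  induction k with
  | zero => exact ⟨0, 0, ⟨by simp, by simp, by simp, by simp, by simp, by simp, by simp, by simp⟩⟩
  | succ k ih =>
    obtain ⟨e, f, h⟩ := ih (by omega)
    set T : V →ₗ[K] (Fin k → K) × (Fin k → K) :=
      (LinearMap.pi fun i : Fin k => B (e i)).prod
        (LinearMap.pi fun i : Fin k => B (f i)) with hT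
    have hker : LinearMap.ker T ≠ ⊥ := by
      refine LinearMap.ker_ne_bot_of_finrank_lt ?_
      rw [Module.finrank_prod, Module.finrank_fin_fun, hn]
      omega
    obtain ⟨v, hv, hv0⟩ := Submodule.exists_mem_ne_zero_of_ne_bot hker
    have hv' : ∀ i, B (e i) v = 0 ∧ B (f i) v = 0 := by
      intro i
      by_cases hi : i < k
      · have h1 : T v = 0 := hv
        exact ⟨congrFun (congrArg Prod.fst h1) ⟨i, hi⟩, congrFun (congrArg Prod.snd h1) ⟨i, hi⟩⟩
      · rw [h.left_zero i (not_lt.1 hi), h.right_zero i (not_lt.1 hi)]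
        simp
    obtain ⟨p, hp, q, hq, hpo, hqo, hpq⟩ := h.exists_pair hΛ hv0 hv'
    have hpo' : ∀ i, B p (e i) = 0 ∧ B p (f i) = 0 := fun i => by
      rw [hΛ.neg_eq, (hpo i).1, hΛ.neg_eq p, (hpo i).2]
      simp
    have hqo' : ∀ i, B q (e i) = 0 ∧ B q (f i) = 0 := fun i => by
      rw [hΛ.neg_eq, (hqo i).1, hΛ.neg_eq q, (hqo i).2]
      simp
    refine ⟨Function.update e k p, Function.update f k q, ⟨?_, ?_, ?_, ?_, ?_, ?_, ?_, ?_⟩⟩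
    · intro i
      rcases eq_or_ne i k with rfl | hi
      · simpa
      · simpa [hi] using h.left_mem i
    · intro i
      rcases eq_or_ne i k with rfl | hi
      · simpa
      · simpa [hi] using h.right_mem i
    · intro i j
      simp only [Function.update_apply]
      split_ifs <;> simp [h.left_left, hΛ.alternating, hpo, hpo']
    · intro i j
      simp only [Function.update_apply]
      split_ifs <;> simp [h.right_right, hΛ.alternating, hqo, hqo']
    · intro i j hij
      simp only [Function.update_apply]
      split_ifs with hi hj
      · exact absurd (hi.trans hj.symm) hij
      · exact (hpo' j).2
      · exact (hqo i).1
      · exact h.left_right_ne i j hij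
    · intro i hi'
      rcases eq_or_ne i k with rfl | hi
      · simpa
      · simpa [hi] using h.left_right i (by omega)
    · intro i hi'
      have hi : i ≠ k := by omega
      simpa [hi] using h.left_zero i (by omega)
    · intro i hi'
      have hi : i ≠ k := by omega
      simpa [hi] using h.right_zero i (by omega)

end Basis

/-! ### The functional counting free flags -/

section Functional

variable {R K V : Type*} [CommRing R] [Field K] [Algebra R K] [AddCommGroup V] [Module K V]
  [Module R V]

/-- The step of a flag at `k` is free if the quotient of the `k`-th subspace by the previous one
contains a vector that pairs onto `R` with the lattice vectors orthogonal to the previous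
subspaces. -/
def IsFreeStep {B : LinearMap.BilinForm K V} (Λ : Submodule R V) {n : ℕ}
    (p : Flag (IsotropicPoset B) n) (k : Fin n) : Prop :=
  ∃ v ∈ (p.1 k).1,
    (∀ x ∈ Λ, (∀ j < k, ∀ u ∈ (p.1 j).1, B u x = 0) → B v x ∈ (1 : Submodule R K)) ∧
    ∃ x ∈ Λ, (∀ j < k, ∀ u ∈ (p.1 j).1, B u x = 0) ∧ B v x = 1

open Classical in
/-- The linear functional on chains that counts the flags all of whose steps are free. -/
def freeFlagCount {B : LinearMap.BilinForm K V} (Λ : Submodule R V) (n : ℕ) :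
    Chains (IsotropicPoset B) n →ₗ[ℤ] ℤ :=
  Finsupp.linearCombination ℤ fun p => if ∀ k, IsFreeStep Λ p k then 1 else 0

variable {B : LinearMap.BilinForm K V} {Λ : Submodule R V} {n : ℕ}

lemma IsSelfDualLattice.finrank_le [FiniteDimensional K V] (hΛ : IsSelfDualLattice B Λ)
    (hn : Module.finrank K V = 2 * n) {U : Submodule K V} (hU : IsIsotropic B U) :
    Module.finrank K U ≤ n := by
  have hB : B.Nondegenerate := by
    constructor
    · intro v hv
      exact hΛ.nondegenerate v fun x _ => hv x
    · intro v hv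
      refine hΛ.nondegenerate v fun x _ => ?_
      rw [hΛ.neg_eq, hv x, neg_zero]
  have h1 : U ≤ B.orthogonal U := fun x hx y hy => hU y hy x hx
  have h2 := Submodule.finrank_mono h1
  rw [LinearMap.BilinForm.finrank_orthogonal hB, hn] at h2
  omega

lemma IsSelfDualLattice.isEmpty_flag [FiniteDimensional K V] (hΛ : IsSelfDualLattice B Λ)
    (hn : Module.finrank K V = 2 * n) : IsEmpty (Flag (IsotropicPoset B) (n + 1)) := by
  refine ⟨fun p => ?_⟩
  have h : ∀ i : Fin (n + 1), (i : ℕ) + 1 ≤ Module.finrank K (p.1 i).1 := by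
    intro i
    induction i using Fin.induction with
    | zero =>
      rw [Fin.val_zero, zero_add, Nat.one_le_iff_ne_zero, Ne, Submodule.finrank_eq_zero]
      exact (p.1 0).2.1
    | succ i ih =>
      have h1 : (p.1 i.castSucc).1 < (p.1 i.succ).1 := p.2 (Fin.castSucc_lt_succ)
      have h2 := Submodule.finrank_lt_finrank_of_lt h1
      simp only [Fin.val_castSucc, Fin.val_succ] at *
      omega
  have h1 := h (Fin.last n)
  have h2 := hΛ.finrank_le hn (p.1 (Fin.last n)).2.2
  simp only [Fin.val_last] at h1
  omega

lemma boundaries_eq_bot {P : Type*} [PartialOrder P] [IsEmpty (Flag P (n + 1))] :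
    boundaries P n = ⊥ := by
  rw [boundaries, LinearMap.range_eq_bot]
  refine LinearMap.ext fun c => ?_
  rw [Subsingleton.elim c 0, map_zero, map_zero]

/-- A functional on chains descends to the top-dimensional homology. -/
lemma exists_functional {P : Type*} [PartialOrder P] [IsEmpty (Flag P (n + 1))]
    (φ : Chains P n →ₗ[ℤ] ℤ) :
    ∃ Φ : ReducedHomology P n →ₗ[ℤ] ℤ, ∀ c : cycles P n, Φ (Submodule.Quotient.mk c) = φ c.1 := by
  refine ⟨Submodule.liftQ _ (φ ∘ₗ (cycles P n).subtype) ?_, fun c => rfl⟩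
  intro c hc
  have h1 : c.1 ∈ boundaries P n := hc
  rw [boundaries_eq_bot, Submodule.mem_bot] at h1
  change φ c.1 = 0
  rw [h1, map_zero]

/-! ### Vanishing on integral apartments -/

namespace SymplecticFrame

variable (L : SymplecticFrame B n)

open Classical in
lemma freeFlagCount_apartmentChain :
    freeFlagCount Λ n L.apartmentChain = ∑ σ : SignedPerm n,
      (-1 : ℤ) ^ len σ * if ∀ k, IsFreeStep Λ (L.chamber σ) k then 1 else 0 := by
  simp [freeFlagCount, apartmentChain]

lemma neg_one_pow_len_int (σ : SignedPerm n) : (-1 : ℤ) ^ len σ = (signHom σ : ℤ) := by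
  rw [← neg_one_pow_len]
  simp

/-- Right multiplication by a single sign change is a bijection that reverses the sign; it exists
because n ≥ 1. -/
lemma sum_neg_one_pow_len (hn : 1 ≤ n) : ∑ σ : SignedPerm n, (-1 : ℤ) ^ len σ = 0 := by
  refine self_eq_neg.1 ?_
  rw [← Finset.sum_neg_distrib]
  refine (Equiv.sum_comp (Equiv.mulRight (negAt ⟨0, hn⟩)) _).symm.trans
    (Finset.sum_congr rfl fun σ _ => ?_)
  rw [Equiv.coe_mulRight, neg_one_pow_len_int, neg_one_pow_len_int, map_mul, signHom_negAt]
  simp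

lemma span_orthogonal_iff (σ : SignedPerm n) (k : Fin n) (x : V) :
    (∀ j < k, ∀ u ∈ L.span σ j, B u x = 0) ↔ ∀ j < k, ∀ u ∈ L.line (σ.1 (j, 1)), B u x = 0 := by
  constructor
  · intro h j hj u hu
    exact h j hj u (L.line_le_span σ le_rfl hu)
  · intro h j hj u hu
    refine Submodule.iSup_induction _ (motive := fun u => B u x = 0) hu (fun i u hu => ?_)
      (by simp) (fun a b ha hb => by simp [ha, hb])
    exact h i (lt_of_le_of_lt i.2 hj) u hu

/-- The part of v in the preceding subspace pairs to zero with every admissible x, so only its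
component in the newly added line matters. -/
lemma isFreeStep_chamber_iff (σ : SignedPerm n) (k : Fin n) :
    IsFreeStep Λ (L.chamber σ) k ↔ ∃ v ∈ L.line (σ.1 (k, 1)),
      (∀ x ∈ Λ, (∀ j < k, ∀ u ∈ L.line (σ.1 (j, 1)), B u x = 0) → B v x ∈ (1 : Submodule R K)) ∧
      ∃ x ∈ Λ, (∀ j < k, ∀ u ∈ L.line (σ.1 (j, 1)), B u x = 0) ∧ B v x = 1 := by
  change (∃ v ∈ L.span σ k, (∀ x ∈ Λ, (∀ j < k, ∀ u ∈ L.span σ j, B u x = 0) → _) ∧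
    ∃ x ∈ Λ, (∀ j < k, ∀ u ∈ L.span σ j, B u x = 0) ∧ _) ↔ _
  simp only [span_orthogonal_iff]
  constructor
  · rintro ⟨v, hv, h1, h2⟩
    have hle : L.span σ k ≤ (⨆ j : {j : Fin n // j < k}, L.line (σ.1 (j.1, 1))) ⊔
        L.line (σ.1 (k, 1)) := by
      refine iSup_le fun j => ?_
      rcases lt_or_eq_of_le j.2 with hj | hj
      · exact le_sup_of_le_left
          (le_iSup (fun j : {j : Fin n // j < k} => L.line (σ.1 (j.1, 1))) ⟨j.1, hj⟩)
      · rw [hj]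
        exact le_sup_right
    obtain ⟨u, hu, l, hl, rfl⟩ := Submodule.mem_sup.1 (hle hv)
    have hul : ∀ x, (∀ j < k, ∀ u ∈ L.line (σ.1 (j, 1)), B u x = 0) → B (u + l) x = B l x := by
      intro x hx
      have h0 : B u x = 0 := by
        refine Submodule.iSup_induction _ (motive := fun u => B u x = 0) hu (fun i u hu => ?_)
          (by simp) (fun a b ha hb => by simp [ha, hb])
        exact hx i.1 i.2 u hu
      rw [map_add, LinearMap.add_apply, h0, zero_add]
    refine ⟨l, hl, fun x hx hx' => ?_, ?_⟩
    · rw [← hul x hx']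
      exact h1 x hx hx'
    · obtain ⟨x, hx, hx', h⟩ := h2
      exact ⟨x, hx, hx', by rw [← hul x hx', h]⟩
  · rintro ⟨v, hv, h⟩
    exact ⟨v, L.line_le_span σ le_rfl hv, h⟩

/-- A line is free if it contains a vector that pairs onto `R` with the lattice. -/
def IsFreeLine (Λ : Submodule R V) (i : SignedIndex n) : Prop :=
  ∃ v ∈ L.line i, (∀ x ∈ Λ, B v x ∈ (1 : Submodule R K)) ∧ ∃ x ∈ Λ, B v x = 1

/-- The lattice is the sum of its intersections with the lines of the frame. -/
def Decomposes (Λ : Submodule R V) : Prop :=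
  ∀ x ∈ Λ, ∃ m : SignedIndex n → V, (∀ i, m i ∈ Λ ∧ m i ∈ L.line i) ∧ ∑ i, m i = x

variable {L}

lemma apply_sum_eq {i : SignedIndex n} {v : V} (hv : v ∈ L.line i) {m : SignedIndex n → V}
    (hm : ∀ i, m i ∈ L.line i) : B v (∑ j, m j) = B v (m i.opp) := by
  rw [map_sum]
  refine Finset.sum_eq_single _ (fun j _ hj => L.apply_eq_zero hj hv (hm j)) fun h => ?_
  exact absurd (Finset.mem_univ _) h

/-- If v generates at L_i and x is a lattice vector with B(v, x) = 1, then the L_{-i}-component of x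
also pairs to 1 with v, and its negative generates at L_{-i}. Self-duality puts v into Λ, where it
serves as the new test vector. -/
lemma Decomposes.isFreeLine_opp (hL : L.Decomposes Λ) (hΛ : IsSelfDualLattice B Λ)
    {i : SignedIndex n} (h : L.IsFreeLine Λ i) : L.IsFreeLine Λ i.opp := by
  obtain ⟨v, hv, h1, x, hx, h2⟩ := h
  obtain ⟨m, hm, rfl⟩ := hL x hx
  rw [apply_sum_eq hv fun i => (hm i).2] at h2
  refine ⟨-m i.opp, Submodule.neg_mem _ (hm _).2, ?_, v, hΛ.selfDual v h1, ?_⟩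
  · exact hΛ.integral _ (Λ.neg_mem (hm _).1)
  · rw [hΛ.neg_eq, map_neg, h2, neg_neg]

/-- A vector of L_i sees only the L_{-i}-component of a lattice vector. That component lies in Λ and
is orthogonal to the earlier lines, so restricting the test vectors to the orthogonal complement
changes nothing. -/
lemma Decomposes.isFreeStep_iff (hL : L.Decomposes Λ) (σ : SignedPerm n) (k : Fin n) :
    IsFreeStep Λ (L.chamber σ) k ↔ L.IsFreeLine Λ (σ.1 (k, 1)) := by
  rw [isFreeStep_chamber_iff]
  set i := σ.1 (k, 1) with hi
  have hort : ∀ y ∈ L.line i.opp, ∀ j < k, ∀ u ∈ L.line (σ.1 (j, 1)), B u y = 0 := by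
    intro y hy j hj u hu
    refine L.apply_eq_zero (fun h => hj.ne ?_) hu hy
    have h1 : i = σ.1 (j, 1) := by rw [← opp_opp i, h, opp_opp]
    exact (congrArg Prod.fst (σ.1.injective h1)).symm
  refine exists_congr fun v => and_congr_right fun hv => ?_
  constructor
  · rintro ⟨h1, x, hx, -, h2⟩
    refine ⟨fun y hy => ?_, x, hx, h2⟩
    obtain ⟨m, hm, rfl⟩ := hL y hy
    rw [apply_sum_eq hv fun i => (hm i).2]
    exact h1 _ (hm _).1 (hort _ (hm _).2)
  · rintro ⟨h1, x, hx, h2⟩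
    refine ⟨fun y hy _ => h1 y hy, ?_⟩
    obtain ⟨m, hm, rfl⟩ := hL x hx
    rw [apply_sum_eq hv fun i => (hm i).2] at h2
    exact ⟨_, (hm _).1, hort _ (hm _).2, h2⟩

/-- For an integral frame, either all chambers or none have only free steps. -/
lemma Decomposes.freeFlagCount_eq_zero (hL : L.Decomposes Λ) (hΛ : IsSelfDualLattice B Λ)
    (hn : 1 ≤ n) : freeFlagCount Λ n L.apartmentChain = 0 := by
  classical
  have hopp : ∀ i : SignedIndex n, L.IsFreeLine Λ i ↔ L.IsFreeLine Λ (i.1, 1) := by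
    rintro ⟨j, ε⟩
    rcases Int.units_eq_one_or ε with rfl | rfl
    · rfl
    · refine ⟨fun h => ?_, fun h => hL.isFreeLine_opp hΛ h⟩
      simpa [SignedIndex.opp] using hL.isFreeLine_opp hΛ h
  have hiff : ∀ σ : SignedPerm n, (∀ k, IsFreeStep Λ (L.chamber σ) k) ↔
      ∀ k, L.IsFreeLine Λ (k, 1) := by
    intro σ
    simp only [hL.isFreeStep_iff]
    rw [← (absPerm σ).forall_congr_right (q := fun k => L.IsFreeLine Λ (k, 1))]
    exact forall_congr' fun k => hopp _
  rw [freeFlagCount_apartmentChain]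
  simp only [hiff]
  rw [← Finset.sum_mul, sum_neg_one_pow_len hn, zero_mul]

end SymplecticFrame

end Functional

/-! ### Dual sequences with non-principal values -/

section Frame

variable {R K V : Type*} [CommRing R] [Field K] [Algebra R K] [AddCommGroup V] [Module K V]
  [Module R V] {B : LinearMap.BilinForm K V} {Λ : Submodule R V} {n : ℕ} {e f g : ℕ → V} {r : K}

/-- The recursion for the vectors dual to `e i + r • e (i + 1)`. -/
def IsDualSequence (e f g : ℕ → V) (r : K) : Prop :=
  (∃ c : K, g 0 = f 0 + c • e 0) ∧ ∀ m, ∃ c : K, g (m + 1) = f (m + 1) - r • g m + c • e (m + 1)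

lemma IsDualSequence.orthogonal (hg : IsDualSequence e f g r) (h : IsSymplecticSequence B Λ n e f)
    (hΛ : IsSelfDualLattice B Λ) (j : ℕ) : ∀ i, j < i → B (e i) (g j) = 0 ∧ B (f i) (g j) = 0 := by
  induction j with
  | zero =>
    intro i hi
    obtain ⟨c, hc⟩ := hg.1
    simp [hc, h.left_left, h.right_right, h.left_right_ne i 0 hi.ne',
      h.right_left_ne hΛ i 0 hi.ne']
  | succ j ih =>
    intro i hi
    obtain ⟨c, hc⟩ := hg.2 j
    have h1 := ih i (by omega)
    simp [hc, h.left_left, h.right_right, h.left_right_ne i _ hi.ne',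
      h.right_left_ne hΛ i _ hi.ne', h1]

lemma IsDualSequence.left_self (hg : IsDualSequence e f g r) (h : IsSymplecticSequence B Λ n e f)
    (hΛ : IsSelfDualLattice B Λ) (i : ℕ) (hi : i < n) : B (e i) (g i) = 1 := by
  cases i with
  | zero =>
    obtain ⟨c, hc⟩ := hg.1
    simp [hc, h.left_left, h.left_right 0 hi]
  | succ j =>
    obtain ⟨c, hc⟩ := hg.2 j
    simp [hc, h.left_left, h.left_right _ hi, (hg.orthogonal h hΛ j (j + 1) (by omega)).1]

/-- For j = i + 1 the term -r g_i contributes -r and cancels the r coming from r e_{i+1} against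
f_{i+1}. For larger j the recursion passes the zero on, and for j < i both terms vanish by
`IsDualSequence.orthogonal`. -/
lemma IsDualSequence.sum_apply (hg : IsDualSequence e f g r) (h : IsSymplecticSequence B Λ n e f)
    (hΛ : IsSelfDualLattice B Λ) (i j : ℕ) (hij : i ≠ j) (hj : j < n) :
    B (e i + r • e (i + 1)) (g j) = 0 := by
  rcases lt_or_gt_of_ne hij with hlt | hlt
  · induction j, (Nat.succ_le_of_lt hlt) using Nat.le_induction with
    | base =>
      obtain ⟨c, hc⟩ := hg.2 i
      have h1 := (hg.orthogonal h hΛ i (i + 1) (by omega)).1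
      simp [hc, h.left_left, h.left_right _ hj, h.left_right_ne i (i + 1) (by omega), h1,
        hg.left_self h hΛ i (by omega)]
    | succ j hle ih =>
      obtain ⟨c, hc⟩ := hg.2 j
      have h1 := ih (by omega) (by omega) (by omega)
      rw [hc, map_add, map_sub, map_smul, h1]
      simp [h.left_left, h.left_right_ne i (j + 1) (by omega),
        h.left_right_ne (i + 1) (j + 1) (by omega)]
  · simp [(hg.orthogonal h hΛ j i hlt).1, (hg.orthogonal h hΛ j (i + 1) (by omega)).1]

lemma IsDualSequence.sum_apply_self (hg : IsDualSequence e f g r)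
    (h : IsSymplecticSequence B Λ n e f) (hΛ : IsSelfDualLattice B Λ) (i : ℕ) (hi : i < n) :
    B (e i + r • e (i + 1)) (g i) = 1 := by
  simp [hg.left_self h hΛ i hi, (hg.orthogonal h hΛ i (i + 1) (by omega)).1]

lemma IsDualSequence.apply_eq_zero (hg : IsDualSequence e f g r)
    (h : IsSymplecticSequence B Λ n e f) (hΛ : IsSelfDualLattice B Λ) (i j : ℕ) :
    B (g i) (g j) = 0 := by
  wlog hij : i ≤ j generalizing i j
  · rw [hΛ.neg_eq, this j i (by omega), neg_zero]
  induction j, hij using Nat.le_induction with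
  | base => exact hΛ.alternating _
  | succ j hij ih =>
    obtain ⟨c, hc⟩ := hg.2 j
    have h1 := hg.orthogonal h hΛ i (j + 1) (by omega)
    rw [hc, map_add, map_sub, map_smul, map_smul, ih, hΛ.neg_eq _ (f _), hΛ.neg_eq _ (e _), h1.1,
      h1.2]
    simp

variable [IsScalarTower R K V]

/-- The test vector v gives the value s, so multiples of s can be subtracted from the values of w +
s u to recover those of w. -/
lemma content_add_smul {w u v : V} (hv : v ∈ Λ) (hwv : B w v = 0) (huv : B u v = 1)
    (hint : ∀ x ∈ Λ, B u x ∈ (1 : Submodule R K)) (s : K) :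
    content B Λ (w + s • u) = content B Λ w ⊔ R ∙ s := by
  apply le_antisymm
  · rintro _ ⟨x, hx, rfl⟩
    obtain ⟨a, ha⟩ := Submodule.mem_one.1 (hint x hx)
    change B (w + s • u) x ∈ _
    rw [map_add, map_smul, LinearMap.add_apply, LinearMap.smul_apply, ← ha, smul_eq_mul, mul_comm,
      ← Algebra.smul_def]
    exact Submodule.add_mem_sup ⟨x, hx, rfl⟩
      (Submodule.smul_mem _ _ (Submodule.mem_span_singleton_self _))
  · have hs : ∀ a : R, a • s ∈ content B Λ (w + s • u) := fun a => by
      refine Submodule.smul_mem _ a (mem_content.2 ⟨v, hv, ?_⟩)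
      simp [hwv, huv]
    refine sup_le ?_ ?_
    · rintro _ ⟨x, hx, rfl⟩
      obtain ⟨a, ha⟩ := Submodule.mem_one.1 (hint x hx)
      have h1 := hs a
      have h2 : B (w + s • u) x ∈ content B Λ (w + s • u) := ⟨x, hx, rfl⟩
      have h3 := Submodule.sub_mem _ h2 h1
      rw [map_add, map_smul, LinearMap.add_apply, LinearMap.smul_apply, ← ha, smul_eq_mul, mul_comm,
        ← Algebra.smul_def, add_sub_cancel_right] at h3
      exact h3
    · rw [Submodule.span_singleton_le_iff_mem]
      simpa using hs 1

variable [IsDedekindDomain R] [IsFractionRing R K]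

/-- The duality relations leave the coefficient of e_m in g_m free. By `content_add_smul` it adjoins
an arbitrary generator to the value module, which `exists_sup_span_ne` makes non-principal. -/
lemma exists_dualSequence {I : Ideal R} (hI : ¬ I.IsPrincipal)
    (h : IsSymplecticSequence B Λ n e f) (hΛ : IsSelfDualLattice B Λ) (r : K) :
    ∃ g : ℕ → V, IsDualSequence e f g r ∧ ∀ i < n, ∀ t : K, content B Λ (g i) ≠ R ∙ t := by
  classical
  -- Choosing s for every w, with 0 as a dummy when the value module vanishes, allows g to be
  -- defined by plain recursion.
  have hs : ∀ w : V, ∃ s : K, content B Λ w ≠ ⊥ → ∀ t : K, content B Λ w ⊔ R ∙ s ≠ R ∙ t := by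
    intro w
    by_cases hw : content B Λ w = ⊥
    · exact ⟨0, fun h => absurd hw h⟩
    · obtain ⟨s, hs⟩ := exists_sup_span_ne hI (hΛ.fg.map ((B w).restrictScalars R)) hw
      exact ⟨s, fun _ => hs⟩
  choose s hs using hs
  set g : ℕ → V := fun m => Nat.rec (f 0 + s (f 0) • e 0)
    (fun m v => f (m + 1) - r • v + s (f (m + 1) - r • v) • e (m + 1)) m with hgdef
  have hg0 : g 0 = f 0 + s (f 0) • e 0 := rfl
  have hg1 : ∀ m, g (m + 1) = f (m + 1) - r • g m + s (f (m + 1) - r • g m) • e (m + 1) :=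
    fun m => rfl
  have hg : IsDualSequence e f g r := ⟨⟨_, hg0⟩, fun m => ⟨_, hg1 m⟩⟩
  have key : ∀ i < n, ∀ w : V, B w (f i) = 0 → B (e i) w = 1 → ∀ t : K,
      content B Λ (w + s w • e i) ≠ R ∙ t := by
    intro i hi w h1 h2 t
    rw [content_add_smul (h.right_mem i) h1 (h.left_right i hi)
      (hΛ.integral _ (h.left_mem i))]
    refine hs w (fun h0 => ?_) t
    have h3 : B w (e i) ∈ content B Λ w := ⟨e i, h.left_mem i, rfl⟩
    rw [h0, Submodule.mem_bot, hΛ.neg_eq, h2] at h3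
    simp at h3
  refine ⟨g, hg, fun i hi => ?_⟩
  cases i with
  | zero =>
    rw [hg0]
    exact key 0 hi _ (h.right_right _ _) (h.left_right 0 hi)
  | succ i =>
    have h1 := hg.orthogonal h hΛ i (i + 1) (by omega)
    rw [hg1]
    refine key _ hi _ ?_ ?_
    · simp [h.right_right, hΛ.neg_eq (g i), h1.2]
    · simp [h.left_right _ hi, h1.1]

omit [IsDedekindDomain R] [IsFractionRing R K] in
/-- Lattice vectors can be made orthogonal to the last vectors of the sequence without changing
their pairing with the first vectors of the dual sequence. -/
lemma IsDualSequence.exists_orthogonal (hg : IsDualSequence e f g r)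
    (h : IsSymplecticSequence B Λ n e f) (hΛ : IsSelfDualLattice B Λ) (k : ℕ) {x : V}
    (hx : x ∈ Λ) : ∃ x' ∈ Λ, (∀ j, k < j → B (e j) x' = 0) ∧ ∀ i ≤ k, B (g i) x' = B (g i) x := by
  -- Subtracting multiples of f j with j > k corrects the pairings with e j, and g i is orthogonal
  -- to these f j for i ≤ k.
  refine ⟨x - ∑ j ∈ Finset.Ioo k n, B (e j) x • f j, ?_, ?_, ?_⟩
  · refine Λ.sub_mem hx (Λ.sum_mem fun i _ => ?_)
    exact smul_mem_of_mem_one (hΛ.integral _ (h.left_mem i) _ hx) (h.right_mem i)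
  · intro i hki
    by_cases hi : i < n
    · simp only [map_sub, map_sum, map_smul]
      rw [Finset.sum_eq_single i, h.left_right i hi]
      · simp
      · intro j _ hj
        rw [h.left_right_ne i j hj.symm, smul_zero]
      · intro hi'
        exact absurd (Finset.mem_Ioo.2 ⟨hki, hi⟩) hi'
    · rw [h.left_zero i (not_lt.1 hi)]
      simp
  · intro i hi
    simp only [map_sub, map_sum, map_smul]
    rw [Finset.sum_eq_zero, sub_zero]
    intro j hj
    rw [hΛ.neg_eq (g i), (hg.orthogonal h hΛ i j (hi.trans_lt (Finset.mem_Ioo.1 hj).1)).2]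
    simp

-- Restricting to lattice vectors orthogonal to the e j with j > k does not shrink the values of g
-- i, so a generator c g i would give B(g i, Λ) = R c⁻¹.
omit [IsDedekindDomain R] [IsFractionRing R K] in
lemma not_free_dual (hg : IsDualSequence e f g r)
    (h : IsSymplecticSequence B Λ n e f) (hΛ : IsSelfDualLattice B Λ) {i k : ℕ} (hik : i ≤ k)
    (hgi : ∀ t : K, content B Λ (g i) ≠ R ∙ t) (c : K)
    (h1 : ∀ x ∈ Λ, (∀ j, k < j → B (e j) x = 0) → B (c • g i) x ∈ (1 : Submodule R K))
    (h2 : ∃ x ∈ Λ, B (c • g i) x = 1) : False := by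
  obtain ⟨x, hx, h2⟩ := h2
  have hc : c ≠ 0 := by
    rintro rfl
    simp at h2
  simp only [map_smul, LinearMap.smul_apply, smul_eq_mul] at h1 h2
  refine hgi c⁻¹ (le_antisymm ?_ ?_)
  · rintro _ ⟨y, hy, rfl⟩
    obtain ⟨y', hy', ho, hyy⟩ := hg.exists_orthogonal h hΛ k hy
    obtain ⟨a, ha⟩ := Submodule.mem_one.1 (h1 y' hy' ho)
    refine Submodule.mem_span_singleton.2 ⟨a, ?_⟩
    change _ = B (g i) y
    rw [Algebra.smul_def, ha, hyy i hik]
    field_simp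
  · rw [Submodule.span_singleton_le_iff_mem]
    exact mem_content.2 ⟨x, hx, eq_inv_of_mul_eq_one_right h2⟩

-- Since i + 1 ≤ k, both f i and f (i + 1) are admissible test vectors; they give the values c and c
-- r. A generator would thus force R + Rr = R c⁻¹.
omit [IsScalarTower R K V] [IsDedekindDomain R] [IsFractionRing R K] in
lemma not_free_sum (h : IsSymplecticSequence B Λ n e f) (hΛ : IsSelfDualLattice B Λ) {i k : ℕ}
    (hik : i < k) (hk : k < n) (hr : ∀ t : K, (1 : Submodule R K) ⊔ R ∙ r ≠ R ∙ t) (c : K)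
    (h1 : ∀ x ∈ Λ, (∀ j, k < j → B (e j) x = 0) →
      B (c • (e i + r • e (i + 1))) x ∈ (1 : Submodule R K))
    (h2 : ∃ x ∈ Λ, B (c • (e i + r • e (i + 1))) x = 1) : False := by
  obtain ⟨x, hx, h2⟩ := h2
  have hc : c ≠ 0 := by
    rintro rfl
    simp at h2
  simp only [map_smul, map_add, LinearMap.add_apply, LinearMap.smul_apply, smul_eq_mul] at h1 h2
  have hf : ∀ m ≤ k, ∀ j, k < j → B (e j) (f m) = 0 := fun m hm j hj =>
    h.left_right_ne j m (by omega)
  have hc1 := h1 (f i) (h.right_mem i) (hf i hik.le)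
  have hc2 := h1 (f (i + 1)) (h.right_mem _) (hf _ hik)
  rw [h.left_right i (by omega), h.left_right_ne (i + 1) i (by omega)] at hc1
  rw [h.left_right (i + 1) (by omega), h.left_right_ne i (i + 1) (by omega)] at hc2
  obtain ⟨a, ha⟩ := Submodule.mem_one.1 hc1
  obtain ⟨b, hb⟩ := Submodule.mem_one.1 hc2
  refine hr c⁻¹ (le_antisymm (sup_le ?_ ?_) ?_)
  · rw [Submodule.one_eq_span, Submodule.span_singleton_le_iff_mem]
    refine Submodule.mem_span_singleton.2 ⟨a, ?_⟩
    rw [Algebra.smul_def, ha]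
    field_simp
    simp
  · rw [Submodule.span_singleton_le_iff_mem]
    refine Submodule.mem_span_singleton.2 ⟨b, ?_⟩
    rw [Algebra.smul_def, hb]
    field_simp
    simp
  · rw [Submodule.span_singleton_le_iff_mem, ← eq_inv_of_mul_eq_one_right h2]
    obtain ⟨q, hq⟩ := Submodule.mem_one.1 (hΛ.integral _ (h.left_mem (i + 1)) x hx)
    rw [← hq, mul_comm r, ← Algebra.smul_def]
    exact Submodule.add_mem_sup (hΛ.integral _ (h.left_mem i) x hx)
      (Submodule.smul_mem _ _ (Submodule.mem_span_singleton_self _))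

/-! ### The apartment with exactly one free chamber -/

/-- The frame vectors: `e m + r • e (m + 1)` and the dual vectors `g m`, in reverse order. -/
def frameVector (e g : ℕ → V) (r : K) (i : SignedIndex n) : V :=
  if i.2 = 1 then e i.1.rev + r • e (i.1.rev + 1) else g i.1.rev

omit [Module R V] [IsScalarTower R K V] [IsDedekindDomain R] [IsFractionRing R K] [CommRing R]
  [Algebra R K] in
lemma isIsotropic_span_sup_span {x y : V} (halt : ∀ x, B x x = 0) :
    IsIsotropic B ((K ∙ x) ⊔ (K ∙ y)) ↔ B x y = 0 := by
  constructor
  · intro h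
    exact h x (Submodule.mem_sup_left (Submodule.mem_span_singleton_self x)) y
      (Submodule.mem_sup_right (Submodule.mem_span_singleton_self y))
  · intro h u hu v hv
    have h' : B y x = 0 := by
      have h1 := halt (x + y)
      simpa [halt, h] using h1
    obtain ⟨_, ha, _, hb, rfl⟩ := Submodule.mem_sup.1 hu
    obtain ⟨_, hc, _, hd, rfl⟩ := Submodule.mem_sup.1 hv
    obtain ⟨a, rfl⟩ := Submodule.mem_span_singleton.1 ha
    obtain ⟨b, rfl⟩ := Submodule.mem_span_singleton.1 hb
    obtain ⟨c, rfl⟩ := Submodule.mem_span_singleton.1 hc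
    obtain ⟨d, rfl⟩ := Submodule.mem_span_singleton.1 hd
    simp [halt, h, h']

omit [IsScalarTower R K V] [IsDedekindDomain R] [IsFractionRing R K] in
lemma frameVector_apply_eq_zero_iff (hg : IsDualSequence e f g r)
    (h : IsSymplecticSequence B Λ n e f) (hΛ : IsSelfDualLattice B Λ) (i j : SignedIndex n) :
    B (frameVector e g r i) (frameVector e g r j) = 0 ↔ j ≠ i.opp := by
  have hlt : ∀ i : Fin n, (i.rev : ℕ) < n := fun i => i.rev.2
  have hinj : ∀ i j : Fin n, i ≠ j → (i.rev : ℕ) ≠ j.rev := fun i j hij h =>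
    hij (Fin.rev_injective (Fin.ext h))
  have hne : (-1 : ℤˣ) ≠ 1 := by decide
  obtain ⟨i, ε⟩ := i
  obtain ⟨j, δ⟩ := j
  rcases Int.units_eq_one_or ε with rfl | rfl <;> rcases Int.units_eq_one_or δ with rfl | rfl
  · simp [frameVector, h.left_left, SignedIndex.opp, hne.symm]
  · by_cases hij : i = j
    · subst hij
      simp only [frameVector, if_true, if_neg hne, hg.sum_apply_self h hΛ _ (hlt i)]
      simp [SignedIndex.opp]
    · simp only [frameVector, if_true, if_neg hne, hg.sum_apply h hΛ _ _ (hinj i j hij) (hlt j)]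
      simp [SignedIndex.opp, Ne.symm hij]
  · by_cases hij : i = j
    · subst hij
      simp only [frameVector, if_true, if_neg hne, hΛ.neg_eq (g _),
        hg.sum_apply_self h hΛ _ (hlt i)]
      simp [SignedIndex.opp]
    · simp only [frameVector, if_true, if_neg hne, hΛ.neg_eq (g _),
        hg.sum_apply h hΛ _ _ (hinj j i (Ne.symm hij)) (hlt i)]
      simp [SignedIndex.opp, Ne.symm hij]
  · simp [frameVector, hne, hg.apply_eq_zero h hΛ, SignedIndex.opp]

/-- The symplectic frame spanned by the frame vectors. -/
def dualFrame (hg : IsDualSequence e f g r) (h : IsSymplecticSequence B Λ n e f)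
    (hΛ : IsSelfDualLattice B Λ) : SymplecticFrame B n where
  line i := K ∙ frameVector e g r i
  finrank_line i := by
    refine finrank_span_singleton fun h0 => ?_
    have h1 := frameVector_apply_eq_zero_iff hg h hΛ i i.opp
    rw [h0] at h1
    simp at h1
  isotropic_iff i j := by
    rw [isIsotropic_span_sup_span hΛ.alternating, frameVector_apply_eq_zero_iff hg h hΛ]

omit [IsDedekindDomain R] [IsFractionRing R K] in
/-- The only chamber of the frame with free steps is the one of the identity. -/
lemma freeFlagCount_dualFrame (hg : IsDualSequence e f g r) (h : IsSymplecticSequence B Λ n e f)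
    (hΛ : IsSelfDualLattice B Λ) (hr : ∀ t : K, (1 : Submodule R K) ⊔ R ∙ r ≠ R ∙ t)
    (hgn : ∀ i < n, ∀ t : K, content B Λ (g i) ≠ R ∙ t) :
    freeFlagCount Λ n (dualFrame hg h hΛ).apartmentChain ≠ 0 := by
  classical
  set L := dualFrame hg h hΛ with hL
  have hline : ∀ i, L.line i = K ∙ frameVector e g r i := fun i => rfl
  have hone : ∀ k, IsFreeStep Λ (L.chamber 1) k := by
    intro k
    rw [SymplecticFrame.isFreeStep_chamber_iff]
    change ∃ v ∈ L.line (k, 1), (∀ x ∈ Λ, (∀ j < k, ∀ u ∈ L.line (j, 1), B u x = 0) → _) ∧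
      ∃ x ∈ Λ, (∀ j < k, ∀ u ∈ L.line (j, 1), B u x = 0) ∧ _
    have hv : ∀ j : Fin n, e j.rev + r • e (j.rev + 1) ∈ L.line (j, 1) := by
      intro j
      rw [hline]
      simp [frameVector]
    refine ⟨_, hv k, ?_, f k.rev, h.right_mem _, ?_, ?_⟩
    · intro x hx hxo
      -- Descending induction from e n = 0: orthogonality to e i + r e (i + 1) and to e (i + 1)
      -- gives orthogonality to e i. Hence x pairs with the k-th frame vector as with e k.rev.
      have hzero : ∀ m, ∀ i ≤ n, n ≤ m + i → (k.rev : ℕ) < i → B (e i) x = 0 := by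
        intro m
        induction m with
        | zero =>
          intro i _ hi _
          rw [h.left_zero i (by omega)]
          simp
        | succ m ih =>
          intro i hin hi hki
          rcases hin.eq_or_lt with rfl | hin
          · rw [h.left_zero _ le_rfl]
            simp
          have h1 := ih (i + 1) (by omega) (by omega) (by omega)
          have h2 := hxo (⟨i, hin⟩ : Fin n).rev (by
            rw [Fin.lt_def]
            simp only [Fin.val_rev] at hki ⊢
            omega) _ (hv _)
          simpa [h1] using h2
      rw [map_add, map_smul, LinearMap.add_apply, LinearMap.smul_apply,
        hzero n (k.rev + 1) k.rev.2 (by omega) (by omega), smul_zero, add_zero]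
      exact hΛ.integral _ (h.left_mem _) x hx
    · intro j hj u hu
      obtain ⟨c, rfl⟩ := Submodule.mem_span_singleton.1 hu
      have h1 : (k.rev : ℕ) < j.rev := Fin.rev_lt_rev.2 hj
      simp [frameVector, -Fin.val_rev, h.left_right_ne j.rev k.rev (by omega),
        h.left_right_ne (j.rev + 1) k.rev (by omega)]
    · simp [-Fin.val_rev, h.left_right _ k.rev.2, h.left_right_ne (k.rev + 1) k.rev (by omega)]
  have huniq : ∀ σ : SignedPerm n, (∀ k, IsFreeStep Λ (L.chamber σ) k) → σ = 1 := by
    intro σ hσ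
    have hfix : ∀ k : Fin n, σ.1 (k, 1) = (k, 1) := by
      intro k
      induction k using WellFoundedLT.induction with
      | _ k ih =>
        obtain ⟨v, hv, h1, x, hx, -, h2⟩ := (L.isFreeStep_chamber_iff σ k).1 (hσ k)
        -- The indices ±j with j < k are already taken, as σ fixes them.
        have hle : k ≤ (σ.1 (k, 1)).1 := by
          by_contra! hlt
          have h3 := ih _ hlt
          rcases Int.units_eq_one_or (σ.1 (k, 1)).2 with h4 | h4
          · have h5 : σ.1 ((σ.1 (k, 1)).1, 1) = σ.1 (k, 1) := h3.trans (Prod.ext rfl h4.symm)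
            exact hlt.ne (congrArg Prod.fst (σ.1.injective h5))
          · have h5 : σ.1 ((σ.1 (k, 1)).1, -1) = σ.1 (k, 1) := by
              have h6 : σ.1 ((σ.1 (k, 1)).1, -1) = (σ.1 ((σ.1 (k, 1)).1, 1)).opp :=
                σ.2 ((σ.1 (k, 1)).1, 1)
              rw [h6, h3]
              exact Prod.ext rfl h4.symm
            exact hlt.ne (congrArg Prod.fst (σ.1.injective h5))
        -- The earlier lines lie in the span of the e j with j > k.rev, so vectors orthogonal to
        -- these are admissible.
        have h1' : ∀ x ∈ Λ, (∀ j, (k.rev : ℕ) < j → B (e j) x = 0) →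
            B v x ∈ (1 : Submodule R K) := by
          intro x hx hxo
          refine h1 x hx fun j hj u hu => ?_
          rw [ih j hj] at hu
          obtain ⟨c, rfl⟩ := Submodule.mem_span_singleton.1 hu
          have h3 : (k.rev : ℕ) < j.rev := Fin.rev_lt_rev.2 hj
          simp [frameVector, -Fin.val_rev, hxo j.rev h3, hxo (j.rev + 1) (by omega)]
        generalize hi : σ.1 (k, 1) = i at hle hv
        obtain ⟨a, ε⟩ := i
        obtain ⟨c, rfl⟩ := Submodule.mem_span_singleton.1 hv
        have hrev : (a.rev : ℕ) ≤ k.rev := Fin.rev_le_rev.2 hle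
        rcases Int.units_eq_one_or ε with rfl | rfl
        · rcases eq_or_lt_of_le hle with hak | hak
          · change k = a at hak
            rw [hak]
          · have hrev' : (a.rev : ℕ) < k.rev := Fin.rev_lt_rev.2 hak
            simp only [frameVector, if_true] at h1' h2
            exact (not_free_sum h hΛ hrev' k.rev.2 hr c h1' ⟨x, hx, h2⟩).elim
        · simp only [frameVector, if_neg (show (-1 : ℤˣ) ≠ 1 by decide)] at h1' h2
          exact (not_free_dual hg h hΛ hrev (hgn _ a.rev.2) c h1' ⟨x, hx, h2⟩).elim
    apply Subtype.ext
    ext1 i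
    obtain ⟨j, ε⟩ := i
    rcases Int.units_eq_one_or ε with rfl | rfl
    · exact hfix j
    · have h6 : σ.1 (j, -1) = (σ.1 (j, 1)).opp := σ.2 (j, 1)
      rw [h6, hfix]
      rfl
  rw [SymplecticFrame.freeFlagCount_apartmentChain, Finset.sum_eq_single 1]
  · rw [if_pos hone, mul_one]
    exact pow_ne_zero _ (by decide)
  · intro σ _ hσ
    rw [if_neg fun h => hσ (huniq σ h), mul_zero]
  · intro h
    exact absurd (Finset.mem_univ _) h

end Frame

/-! ### The standard lattice and integral frames -/

section Standard

variable {R K : Type*} [CommRing R] [IsDedekindDomain R] [Field K] [Algebra R K]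
  [IsFractionRing R K] {n : ℕ}

lemma exists_smul_eq_latticeMap (v : Fin (2 * n) → K) :
    ∃ d : R, d ≠ 0 ∧ ∃ y, latticeMap K R n y = d • v := by
  obtain ⟨d, hd⟩ := IsLocalization.exist_integer_multiples_of_finite (nonZeroDivisors R) v
  choose y hy using hd
  exact ⟨d, nonZeroDivisors.coe_ne_zero d, y, funext hy⟩

lemma isSelfDualLattice_range (ω : LinearMap.BilinForm R (Fin (2 * n) → R))
    (hω : IsSymplecticForm ω) :
    IsSelfDualLattice (extendForm K ω) (LinearMap.range (latticeMap K R n)) := by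
  have hinj := IsFractionRing.injective R K
  have hnd : ∀ v, (∀ x ∈ LinearMap.range (latticeMap K R n), extendForm K ω v x = 0) → v = 0 := by
    intro v hv
    obtain ⟨d, hd0, y, hy⟩ := exists_smul_eq_latticeMap (R := R) v
    have hd0' : algebraMap R K d ≠ 0 := by rwa [Ne, map_eq_zero_iff _ hinj]
    rw [← algebraMap_smul K] at hy
    have hy0 : y = 0 := by
      refine hω.bijective_left.1 (LinearMap.ext fun z => hinj ?_)
      have h1 := hv _ ⟨z, rfl⟩
      rw [← extendForm_latticeMap K ω, hy, map_smul, LinearMap.smul_apply, h1]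
      simp
    rw [hy0, map_zero] at hy
    exact (smul_eq_zero.1 hy.symm).resolve_left hd0'
  refine ⟨?_, ?_, ?_, hnd, ?_, ?_⟩
  · intro v
    obtain ⟨d, hd0, y, hy⟩ := exists_smul_eq_latticeMap (R := R) v
    have hd0' : algebraMap R K d ≠ 0 := by rwa [Ne, map_eq_zero_iff _ hinj]
    have h1 := extendForm_latticeMap K ω y y
    rw [hω.alternating, hy, ← algebraMap_smul K] at h1
    simpa [show d ≠ 0 from hd0] using h1
  · rintro _ ⟨x, rfl⟩ _ ⟨y, rfl⟩
    exact Submodule.mem_one.2 ⟨_, (extendForm_latticeMap K ω x y).symm⟩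
  · intro v hv
    have hint : ∀ y, ∃ a : R, algebraMap R K a = extendForm K ω v (latticeMap K R n y) :=
      fun y => Submodule.mem_one.1 (hv _ ⟨y, rfl⟩)
    choose a ha using hint
    let l : Module.Dual R (Fin (2 * n) → R) :=
      { toFun := a
        map_add' := fun y z => hinj (by simp [ha])
        map_smul' := fun c y => hinj (by
          rw [ha, map_smul, ← algebraMap_smul K, map_smul, RingHom.id_apply, smul_eq_mul, smul_eq_mul,
            map_mul, ha]) }
    -- The R-valued functional B(v, ·) on the lattice is represented by a lattice vector y;
    -- non-degeneracy over K identifies it with v.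
    obtain ⟨y, hy⟩ := hω.bijective_left.2 l
    refine ⟨y, (sub_eq_zero.1 (hnd _ ?_)).symm⟩
    rintro _ ⟨z, rfl⟩
    rw [map_sub, LinearMap.sub_apply, extendForm_latticeMap, ← ha]
    have h1 : ω y z = a z := LinearMap.congr_fun hy z
    rw [h1, sub_self]
  · intro v
    obtain ⟨d, hd0, y, hy⟩ := exists_smul_eq_latticeMap (R := R) v
    exact ⟨d, hd0, y, hy⟩
  · rw [LinearMap.range_eq_map]
    exact Module.Finite.fg_top.map _

omit [IsDedekindDomain R] [IsFractionRing R K] in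
lemma SymplecticFrame.IsIntegral.decomposes {ω : LinearMap.BilinForm R (Fin (2 * n) → R)}
    {L : SymplecticFrame (extendForm K ω) n} (hL : L.IsIntegral) :
    L.Decomposes (LinearMap.range (latticeMap K R n)) := by
  rintro _ ⟨x, rfl⟩
  have hx : x ∈ ⨆ i, ((L.line i).restrictScalars R).comap (latticeMap K R n) := by
    rw [DirectSum.IsInternal.submodule_iSup_eq_top hL]
    trivial
  obtain ⟨y, hy, rfl⟩ := (Submodule.mem_iSup_iff_exists_finsupp _ _).1 hx
  refine ⟨fun i => latticeMap K R n (y i), fun i => ⟨⟨_, rfl⟩, hy i⟩, ?_⟩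
  rw [Finsupp.sum_fintype _ _ fun _ => rfl, map_sum]

omit [IsFractionRing R K] [Algebra R K] [Field K] in
lemma exists_not_isPrincipal [Finite (ClassGroup R)] (hcl : 2 ≤ Nat.card (ClassGroup R)) :
    ∃ I : Ideal R, ¬ I.IsPrincipal := by
  by_contra! h
  have : IsPrincipalIdealRing R := ⟨h⟩
  have := Fintype.ofFinite (ClassGroup R)
  have h1 := card_classGroup_eq_one_iff.2 ‹IsPrincipalIdealRing R›
  rw [Nat.card_eq_fintype_card] at hcl
  omega

end Standard

end SymplecticSteinberg

end

/-! ### The theorem -/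

theorem theorem1p2 {R K : Type*} [CommRing R] [IsDedekindDomain R] [Field K] [Algebra R K]
    [IsFractionRing R K] [Finite (ClassGroup R)] (hcl : 2 ≤ Nat.card (ClassGroup R))
    (n : ℕ) (hn : 1 ≤ n)
    (ω : LinearMap.BilinForm R (Fin (2 * n) → R)) (hω : SymplecticSteinberg.IsSymplecticForm ω) :
    AddSubgroup.closure
        {c : SymplecticSteinberg.SteinbergModule K ω |
          ∃ L : SymplecticSteinberg.SymplecticFrame (SymplecticSteinberg.extendForm K ω) n,
            L.IsIntegral ∧ c = L.apartmentClass} ≠ ⊤ := by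
  open SymplecticSteinberg in
  have hΛ := isSelfDualLattice_range (K := K) ω hω
  have hdim : Module.finrank K (Fin (2 * n) → K) = 2 * n := Module.finrank_fin_fun K
  obtain ⟨I, hI⟩ := exists_not_isPrincipal hcl
  obtain ⟨e, f, h⟩ := exists_symplecticSequence hΛ hdim n le_rfl
  obtain ⟨r, hr⟩ := exists_sup_span_ne (K := K) hI (J := 1)
    (by rw [Submodule.one_eq_span]; exact Submodule.fg_span_singleton _) one_ne_zero
  obtain ⟨g, hg, hgn⟩ := exists_dualSequence hI h hΛ r
  have := hΛ.isEmpty_flag hdim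
  obtain ⟨Φ, hΦ⟩ := exists_functional
    (freeFlagCount (B := extendForm K ω) (LinearMap.range (latticeMap K R n)) n)
  intro htop
  have hle : AddSubgroup.closure {c : SteinbergModule K ω |
      ∃ L : SymplecticFrame (extendForm K ω) n, L.IsIntegral ∧ c = L.apartmentClass} ≤
      Φ.toAddMonoidHom.ker := by
    rw [AddSubgroup.closure_le]
    rintro _ ⟨L, hL, rfl⟩
    exact (hΦ _).trans (hL.decomposes.freeFlagCount_eq_zero hΛ hn)
  have hmem : (dualFrame hg h hΛ).apartmentClass ∈ Φ.toAddMonoidHom.ker :=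
    hle (htop ▸ AddSubgroup.mem_top _)
  exact freeFlagCount_dualFrame hg h hΛ hr hgn ((hΦ _).symm.trans hmem)
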